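/- Work over $\mathbb{C}$. Let $n\ge 0$, $d\ge 0$, $g\ge 1$ be integers with $n\le 2g$ and $d\ge\max(n,2g-2)$. Let $M^n_d$ be the space of nondegenerate morphisms $f=(F_0:\dots:F_n):\mathbb{P}^1\to\mathbb{P}^n$ of degree $d$, each identified with the coefficients of its parametrizing forms: it is the Zariski-open subset of $\mathbb{C}^{(n+1)(d+1)}$ of $(n+1)$-tuples of linearly independent binary forms of degree $d$ without common zero in $\mathbb{P}^1$. For a point $q\in\mathbb{P}^1$ with local parameter $t$, write $f$ near $q$ as $t\mapsto(f_1(t),\dots,f_n(t))$ in affine coordinates centred at $f(q)$. The value semigroup of $f$ at $q$ is the set of $t$-adic valuations of the nonzero elements of the image of $\mathbb{C}[[x_1,\dots,x_n]]\to\mathbb{C}[[t]]$, $x_i\mapsto f_i(t)$. The vanishing orders of $f$ at $q$ are the $n+1$ integers $k_0<k_1<\dots<k_n$ that occur as orders at $t=0$ of nonzero linear combinations of $1,f_1,\dots,f_n$. Let $\mathcal{V}\subset M^n_d$ be the set of morphisms $f$ that are birational onto their image and whose image has exactly one singular point, this point being unibranch with value semigroup $\langle 2,2g+1\rangle$ (a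 hyperelliptic cusp of genus $g$). For $\mathbf{k}=(k_0,\dots,k_n)\in\mathbb{Z}_{\ge0}^{n+1}$ let $\mathcal{V}_{\mathbf{k}}\subset\mathcal{V}$ be the set of those $f$ whose sequence of vanishing orders at the preimage of the cusp is $\mathbf{k}$. If $\mathcal{V}_{\mathbf{k}}\neq\emptyset$, then $$\operatorname{cod}(\mathcal{V}_{\mathbf{k}},M^n_d)\;\ge\;(n-1)g+\sum_{i=2}^n\left(\frac{k_i}{2}-i\right).$$ In particular (and whenever $\mathcal{V}\ne\emptyset$), $\operatorname{cod}(\mathcal{V},M^n_d)\ge (n-1)g$. Here $\operatorname{cod}(Y,M^n_d)=\dim M^n_d-\dim Y$, where the dimension of a subset of affine space is the dimension of its Zariski closure. -/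

import Mathlib

noncomputable section

namespace HyperellipticCusp

/-- A point of the affine space of `(n+1)`-tuples of binary forms of degree `d`:
`a (i, j)` is the coefficient of `x ^ (d - j) * y ^ j` in the `i`-th form `F_i`. -/
abbrev Coeffs (n d : ℕ) : Type := Fin (n + 1) × Fin (d + 1) → ℂ

/-- The value `F_i(x, y)` of the `i`-th form, for `x`, `y` in a commutative `ℂ`-algebra. -/
def formAt {n d : ℕ} (a : Coeffs n d) {A : Type} [CommRing A] [Algebra ℂ A]
    (i : Fin (n + 1)) (x y : A) : A :=
  ∑ j : Fin (d + 1), a (i, j) • (x ^ (d - (j : ℕ)) * y ^ (j : ℕ))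

/-- Two nonzero vectors are proportional, that is, they give the same point of projective space. -/
def SamePoint {m : ℕ} (u v : Fin m → ℂ) : Prop :=
  ∀ i j, u i * v j = u j * v i

/-- The vector `(F_0(v), …, F_n(v))`. -/
def evalAt {n d : ℕ} (a : Coeffs n d) (v : Fin 2 → ℂ) : Fin (n + 1) → ℂ :=
  fun i => formAt a i (v 0) (v 1)

/-- The space `M^n_d` of nondegenerate morphisms `ℙ¹ → ℙⁿ` of degree `d`, each identified with
the coefficients of its parametrizing forms: the forms have no common zero on `ℙ¹`, and they are
linearly independent. -/
def Mor (n d : ℕ) : Set (Coeffs n d) :=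
  {a | (∀ v : Fin 2 → ℂ, v ≠ 0 → evalAt a v ≠ 0) ∧
    LinearIndependent ℂ (fun (i : Fin (n + 1)) (j : Fin (d + 1)) => a (i, j))}

/-- The power series `F_i(v + t w)` in `t`. If `v`, `w` is a basis of `ℂ²`, then `t` is a local
parameter of `ℙ¹` at the point `[v]`. -/
def expansion {n d : ℕ} (a : Coeffs n d) (v w : Fin 2 → ℂ) (i : Fin (n + 1)) : PowerSeries ℂ :=
  formAt a i (PowerSeries.C (v 0) + PowerSeries.C (w 0) * PowerSeries.X)
    (PowerSeries.C (v 1) + PowerSeries.C (w 1) * PowerSeries.X)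

/-- `v`, `w` is a basis of `ℂ²` and the affine chart `z_j ≠ 0` of `ℙⁿ` contains the image
of the point `[v]`. -/
def IsLocalChart {n d : ℕ} (a : Coeffs n d) (v w : Fin 2 → ℂ) (j : Fin (n + 1)) : Prop :=
  v 0 * w 1 - v 1 * w 0 ≠ 0 ∧ evalAt a v j ≠ 0

/-- The local section `F_i / F_j` as a power series in `t`; it equals `1` for `i = j`. -/
def localSection {n d : ℕ} (a : Coeffs n d) (v w : Fin 2 → ℂ) (j i : Fin (n + 1)) :
    PowerSeries ℂ :=
  expansion a v w i * (expansion a v w j)⁻¹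

/-- The `n` power series that describe the morphism near `[v]`, in the affine coordinates
`z_i / z_j` (`i ≠ j`) translated so that the image of `[v]` is the origin. -/
def localCoord {n d : ℕ} (a : Coeffs n d) (v w : Fin 2 → ℂ) (j : Fin (n + 1)) (i : Fin n) :
    PowerSeries ℂ :=
  localSection a v w j (j.succAbove i) -
    PowerSeries.C (PowerSeries.constantCoeff (localSection a v w j (j.succAbove i)))

/-- The power series describing the morphism near a point may be substituted into power series. -/
theorem hasSubst_localCoord {n d : ℕ} (a : Coeffs n d) (v w : Fin 2 → ℂ) (j : Fin (n + 1)) :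
    MvPowerSeries.HasSubst (localCoord a v w j) :=
  MvPowerSeries.hasSubst_of_constantCoeff_zero fun i => by
    change PowerSeries.constantCoeff (localCoord a v w j i) = 0
    simp [localCoord]

/-- The local ring homomorphism `φ : ℂ⟦x_1, …, x_n⟧ → ℂ⟦t⟧`, `x_i ↦ f_i(t)`. -/
def localHom {n d : ℕ} (a : Coeffs n d) (v w : Fin 2 → ℂ) (j : Fin (n + 1)) :
    MvPowerSeries (Fin n) ℂ →ₐ[ℂ] PowerSeries ℂ :=
  MvPowerSeries.substAlgHom (hasSubst_localCoord a v w j)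

/-- The value semigroup: the set of `t`-adic valuations of the nonzero elements of the
image of `φ`. -/
def valueSemigroup {n d : ℕ} (a : Coeffs n d) (v w : Fin 2 → ℂ) (j : Fin (n + 1)) : Set ℕ :=
  {m | ∃ h : MvPowerSeries (Fin n) ℂ, (localHom a v w j h).order = (m : ℕ∞)}

/-- The set of vanishing orders at `t = 0` of the nonzero linear combinations of the local
sections. -/
def vanishingOrders {n d : ℕ} (a : Coeffs n d) (v w : Fin 2 → ℂ) (j : Fin (n + 1)) : Set ℕ :=
  {m | ∃ c : Fin (n + 1) → ℂ, (∑ i, c i • localSection a v w j i).order = (m : ℕ∞)}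

/-- The morphism is injective, and every point of its image other than the image of `[v]` is
smooth (its value semigroup is all of `ℕ`). So the morphism is birational onto its image, every
point of the image is unibranch, and only the image of `[v]` may be singular. -/
def SmoothAwayFrom {n d : ℕ} (a : Coeffs n d) (v : Fin 2 → ℂ) : Prop :=
  (∀ u u' : Fin 2 → ℂ, u ≠ 0 → u' ≠ 0 → SamePoint (evalAt a u) (evalAt a u') → SamePoint u u') ∧
  ∀ (u w : Fin 2 → ℂ) (j : Fin (n + 1)), IsLocalChart a u w j → ¬ SamePoint u v →
    valueSemigroup a u w j = Set.univ

/-- The locus in `M^n_d` of the morphisms whose image is unicuspidal with value semigroup `S`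
at the cusp (for `S ≠ ℕ`). -/
def cuspLocus (n d : ℕ) (S : Set ℕ) : Set (Coeffs n d) :=
  {a | a ∈ Mor n d ∧ ∃ (v w : Fin 2 → ℂ) (j : Fin (n + 1)), IsLocalChart a v w j ∧
    SmoothAwayFrom a v ∧ valueSemigroup a v w j = S}

/-- The stratum of `cuspLocus n d S` of the morphisms for which the strictly increasing sequence
of vanishing orders in the preimage of the cusp is `k = (k_0, …, k_n)`. -/
def cuspStratum (n d : ℕ) (S : Set ℕ) (k : Fin (n + 1) → ℕ) : Set (Coeffs n d) :=
  {a | a ∈ Mor n d ∧ ∃ (v w : Fin 2 → ℂ) (j : Fin (n + 1)), IsLocalChart a v w j ∧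
    SmoothAwayFrom a v ∧ valueSemigroup a v w j = S ∧
    StrictMono k ∧ vanishingOrders a v w j = Set.range k}

/-- The numerical semigroup `⟨2, 2g + 1⟩`. -/
def hyperellipticSemigroup (g : ℕ) : Set ℕ :=
  (AddSubmonoid.closure ({2, 2 * g + 1} : Set ℕ) : Set ℕ)

/-- The dimension of a subset of affine space: the Krull dimension of the coordinate ring of its
Zariski closure (`⊥` for the empty set). -/
def zariskiDim {σ : Type} (X : Set (σ → ℂ)) : WithBot ℕ∞ :=
  ringKrullDim (MvPolynomial σ ℂ ⧸ MvPolynomial.vanishingIdeal ℂ X)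

/-- The subset `Y` of the irreducible variety `X` has codimension `c`: `dim X = dim Y + c`. -/
def HasCodim {σ : Type} (Y X : Set (σ → ℂ)) (c : ℕ) : Prop :=
  zariskiDim Y + ((c : ℕ∞) : WithBot ℕ∞) = zariskiDim X

end HyperellipticCusp

end

/-!
After a linear change of coordinates, the cusp is the image of a point `(1 : θ)`. The sections of
the morphism, expanded at this point, span a space with a unique reduced echelon basis
`G 0, …, G n`, whose leading terms are `t ^ k i`. The value semigroup being `⟨2, 2g + 1⟩`, the
local ring has no element of odd order `< 2g`; subtracting powers of `G 1 / G 0`, which has order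
`2`, one sees that modulo `t ^ (2g)` every `G i` is a linear combination of the series
`G 1 ^ j / G 0 ^ (j - 1)`. Hence for `i ≥ 2` the coefficients of `G i` at the odd exponents below
`2g` are rational functions of the remaining coefficients.

The dimension of the locus is bounded by the number of remaining coefficients, plus the entries of
the matrix expressing the sections in the echelon basis and the position of the cusp. Only the
exponents up to the degree `d` count, so if `d = 2g - 2` then each row `i ≥ 2` seems to lose the
condition at `t ^ (2g - 1)`. But there this coefficient has to vanish. According to the largest `j`
for which it is nonzero in `G 1 ^ j / G 0 ^ (j - 1)`, this gives new relations for the rows `i ≥ 2`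
or for `G 1`, which make up for the loss.
-/

noncomputable section

namespace HyperellipticCusp

section Dimension

open MvPolynomial Topology

theorem ringKrullDim_le_of_isIntegral {R S : Type*} [CommRing R] [CommRing S] [Algebra R S]
    [Algebra.IsIntegral R S] : ringKrullDim S ≤ ringKrullDim R :=
  Order.krullDim_le_of_strictMono (PrimeSpectrum.comap (algebraMap R S)) fun p q hpq =>
    Ideal.IsIntegral.comap_lt_comap (I := p.asIdeal) (J := q.asIdeal) hpq

theorem ringKrullDim_le_of_trdeg_le {K A B : Type*} [Field K] [CommRing A] [Algebra K A]
    [Algebra.FiniteType K A] [CommRing B] [IsDomain B] [Algebra K B] {N : ℕ}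
    (hB : Algebra.trdeg K B ≤ N) (f : A →ₐ[K] B) (hf : Function.Injective f) :
    ringKrullDim A ≤ N := by
  have : Nontrivial A := f.toRingHom.domain_nontrivial
  obtain ⟨s, h, h_inj, h_integral⟩ := exists_integral_inj_algHom_of_fg K A
  have hs : s ≤ N := by
    have h_trdeg := lift_trdeg_le_of_injective (f.comp h) (hf.comp h_inj)
    rw [MvPolynomial.trdeg_of_isDomain] at h_trdeg
    simpa using h_trdeg.trans (Cardinal.lift_le.mpr hB)
  let _ : Algebra (MvPolynomial (Fin s) K) A := h.toRingHom.toAlgebra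
  have : Algebra.IsIntegral (MvPolynomial (Fin s) K) A := ⟨h_integral⟩
  calc ringKrullDim A ≤ ringKrullDim (MvPolynomial (Fin s) K) := ringKrullDim_le_of_isIntegral
    _ = s := by
      rw [MvPolynomial.ringKrullDim_of_isNoetherianRing, ringKrullDim_eq_zero_of_field]
      simp
    _ ≤ N := by exact_mod_cast hs

variable {σ : Type}

theorem zariskiDim_mono {X Y : Set (σ → ℂ)} (h : X ⊆ Y) : zariskiDim X ≤ zariskiDim Y :=
  ringKrullDim_le_of_surjective
    (Ideal.Quotient.factor (vanishingIdeal_anti_mono h)) (Ideal.Quotient.factor_surjective _)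

theorem zariskiDim_empty : zariskiDim (∅ : Set (σ → ℂ)) = ⊥ := by
  rw [zariskiDim, vanishingIdeal_empty]
  exact ringKrullDim_eq_bot_of_subsingleton

theorem zariskiDim_nonneg {X : Set (σ → ℂ)} (h : X.Nonempty) : 0 ≤ zariskiDim X := by
  obtain ⟨x, hx⟩ := h
  have : Nontrivial (MvPolynomial σ ℂ ⧸ vanishingIdeal ℂ X) :=
    Ideal.Quotient.nontrivial_iff.mpr <| (Ideal.ne_top_iff_one _).mpr fun h1 => by
      simpa using mem_vanishingIdeal_iff.mp h1 x hx
  exact ringKrullDim_nonneg_of_nontrivial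

theorem zariskiDim_le_card [Fintype σ] (X : Set (σ → ℂ)) : zariskiDim X ≤ Fintype.card σ := by
  refine (ringKrullDim_quotient_le _).trans ?_
  rw [MvPolynomial.ringKrullDim_of_isNoetherianRing, ringKrullDim_eq_zero_of_field]
  simp

theorem vanishingIdeal_eq_bot_of_isOpen [Finite σ] {X : Set (σ → ℂ)} (hX : IsOpen X)
    (hne : X.Nonempty) : vanishingIdeal ℂ X = (⊥ : Ideal (MvPolynomial σ ℂ)) := by
  obtain ⟨a, ha⟩ := hne
  obtain ⟨s, hs, hsX⟩ := isOpen_pi_iff'.mp hX a ha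
  have h_infinite : ∀ i, (s i).Infinite := fun i =>
    infinite_of_mem_nhds (a i) ((hs i).1.mem_nhds (hs i).2)
  refine eq_bot_iff.mpr fun p hp => MvPolynomial.funext_set s h_infinite fun x hx => ?_
  simpa [aeval_eq_eval] using mem_vanishingIdeal_iff.mp hp x (hsX hx)

theorem zariskiDim_of_isOpen [Fintype σ] {X : Set (σ → ℂ)} (hX : IsOpen X) (hne : X.Nonempty) :
    zariskiDim X = Fintype.card σ := by
  rw [zariskiDim, vanishingIdeal_eq_bot_of_isOpen hX hne,
    ringKrullDim_eq_of_ringEquiv (RingEquiv.quotientBot _),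
    MvPolynomial.ringKrullDim_of_isNoetherianRing, ringKrullDim_eq_zero_of_field]
  simp

theorem exists_zariskiDim_le_of_subset_iUnion {ι : Type*} [Finite ι] {Y : Set (σ → ℂ)}
    (hY : Y.Nonempty) {Z : ι → Set (σ → ℂ)} (hYZ : Y ⊆ ⋃ i, Z i) :
    ∃ i, zariskiDim Y ≤ zariskiDim (Z i) := by
  have := Fintype.ofFinite ι
  have : Nonempty ι := (Set.nonempty_iUnion.mp (hY.mono hYZ)).nonempty
  obtain ⟨i₀, h_max⟩ := Finite.exists_max fun i => zariskiDim (Z i)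
  refine ⟨i₀, (zariskiDim_mono hYZ).trans ?_⟩
  rw [zariskiDim, ringKrullDim_quotient]
  refine iSup_le fun l => ?_
  have h_iInf : ⨅ i, vanishingIdeal ℂ (Z i) ≤ vanishingIdeal ℂ (⋃ i, Z i) := fun p hp => by
    simp only [Ideal.mem_iInf, mem_vanishingIdeal_iff, Set.mem_iUnion] at hp ⊢
    exact fun x ⟨i, hi⟩ => hp i x hi
  obtain ⟨i, -, hi⟩ := l.head.1.isPrime.inf_le'.mp <|
    (Finset.inf_univ_eq_iInf _).trans_le (h_iInf.trans l.head.2)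
  refine le_trans ?_ (h_max i)
  rw [zariskiDim, ringKrullDim_quotient]
  exact Order.LTSeries.length_le_krullDim
    { length := l.length
      toFun := fun j => ⟨(l j).1, fun _ hp => LTSeries.head_le l j (hi hp)⟩
      step := l.step }

theorem exists_hasCodim [Finite σ] {X Y : Set (σ → ℂ)} (hY : Y.Nonempty) (hYX : Y ⊆ X) :
    ∃ c, HasCodim Y X c ∧ ∀ b : ℕ, zariskiDim Y + (b : WithBot ℕ∞) ≤ zariskiDim X → b ≤ c := by
  have := Fintype.ofFinite σ
  have exists_nat {Z : Set (σ → ℂ)} (hZ : Z.Nonempty) : ∃ m : ℕ, zariskiDim Z = m := by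
    generalize h : zariskiDim Z = m
    have h_nonneg := h ▸ zariskiDim_nonneg hZ
    have h_card := h ▸ zariskiDim_le_card Z
    cases m with
    | bot => simp at h_nonneg
    | coe m => cases m with
      | top => exact absurd (top_le_iff.mp (WithBot.coe_le_coe.mp h_card)) (by simp)
      | coe m => exact ⟨m, rfl⟩
  obtain ⟨y, hy⟩ := exists_nat hY
  obtain ⟨x, hx⟩ := exists_nat (hY.mono hYX)
  have hyx : y ≤ x := by simpa [hx, hy] using zariskiDim_mono hYX
  refine ⟨x - y, ?_, fun b hb => ?_⟩
  · rw [HasCodim, hx, hy]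
    norm_cast
    omega
  · rw [hx, hy] at hb
    norm_cast at hb
    omega

end Dimension

section Rational

open MvPolynomial Finset.HasAntidiagonal

variable {K X T : Type*} [Field K] {u : T → X → K}

/-- The polynomials in the functions `u t` without zeros on `X`, the admissible denominators. -/
def nowhereZero (u : T → X → K) : Submonoid (MvPolynomial T K) :=
  (IsUnit.submonoid (X → K)).comap (aeval u : MvPolynomial T K →ₐ[K] X → K)

theorem aeval_mem_nowhereZero (q : nowhereZero u) :
    IsUnit ((aeval u : MvPolynomial T K →ₐ[K] X → K) q) :=
  q.2

/-- Evaluation on `X` of the formal fractions in the `u t` with admissible denominators. -/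
def evalFraction (u : T → X → K) : Localization (nowhereZero u) →ₐ[K] X → K :=
  IsLocalization.liftAlgHom (f := aeval u) aeval_mem_nowhereZero

/-- The functions on `X` that are rational functions, without poles, of the functions `u t`. -/
def rationalFunctions (u : T → X → K) : Subalgebra K (X → K) :=
  (evalFraction u).range

theorem evalFraction_algebraMap (p : MvPolynomial T K) :
    evalFraction u (algebraMap _ _ p) = aeval u p :=
  IsLocalization.lift_eq (g := (aeval u : MvPolynomial T K →ₐ[K] X → K).toRingHom)
    aeval_mem_nowhereZero p

theorem mem_rationalFunctions (t : T) : u t ∈ rationalFunctions u :=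
  ⟨algebraMap (MvPolynomial T K) _ (.X t), (evalFraction_algebraMap _).trans (aeval_X u t)⟩

theorem inv_mem_rationalFunctions {f : X → K} (hf : f ∈ rationalFunctions u)
    (h0 : ∀ x, f x ≠ 0) : f⁻¹ ∈ rationalFunctions u := by
  obtain ⟨z, rfl⟩ := hf
  obtain ⟨p, q, rfl⟩ := IsLocalization.exists_mk'_eq (nowhereZero u) z
  have mk'_mul (p : MvPolynomial T K) (q : nowhereZero u) :
      evalFraction u (IsLocalization.mk' _ p q) * aeval u (q : MvPolynomial T K) = aeval u p := by
    rw [← evalFraction_algebraMap, ← map_mul, IsLocalization.mk'_spec, evalFraction_algebraMap]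
  have f_unit : IsUnit (evalFraction u (IsLocalization.mk' _ p q)) :=
    Pi.isUnit_iff.mpr fun x => (h0 x).isUnit
  have p_mem : p ∈ nowhereZero u := by
    change IsUnit (aeval u p)
    exact mk'_mul p q ▸ f_unit.mul (aeval_mem_nowhereZero q)
  refine ⟨IsLocalization.mk' _ (q : MvPolynomial T K) ⟨p, p_mem⟩, funext fun x => ?_⟩
  have hp := congrFun (mk'_mul p q) x
  have hq := congrFun (mk'_mul q ⟨p, p_mem⟩) x
  have hqx := (Pi.isUnit_iff.mp (aeval_mem_nowhereZero q) x).ne_zero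
  simp only [Pi.mul_apply] at hp hq
  refine eq_inv_of_mul_eq_one_left (mul_right_cancel₀ hqx ?_)
  exact (mul_assoc _ _ _).trans (by rw [one_mul]; exact hp ▸ hq)

theorem zariskiDim_range_le {X T σ : Type} [Fintype T] [Finite σ] {u : T → X → ℂ}
    {y : X → σ → ℂ} (hy : ∀ s, (fun x => y x s) ∈ rationalFunctions u) :
    zariskiDim (Set.range y) ≤ Fintype.card T := by
  rcases isEmpty_or_nonempty X with hX | ⟨⟨x₀⟩⟩
  · rw [Set.range_eq_empty, zariskiDim_empty]
    exact bot_le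
  choose z hz using hy
  let ψ : MvPolynomial σ ℂ →ₐ[ℂ] Localization (nowhereZero u) := aeval z
  have eval_ψ (x : X) (p : MvPolynomial σ ℂ) : evalFraction u (ψ p) x = aeval (y x) p := by
    have : (Pi.evalAlgHom ℂ (fun _ => ℂ) x).comp ((evalFraction u).comp ψ) = aeval (y x) :=
      algHom_ext fun s => by simpa [ψ] using congrFun (hz s) x
    exact DFunLike.congr_fun this p
  have ker_ψ : RingHom.ker ψ ≤ vanishingIdeal ℂ (Set.range y) := fun p hp => by
    rw [mem_vanishingIdeal_iff]
    rintro _ ⟨x, rfl⟩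
    rw [← eval_ψ, RingHom.mem_ker.mp hp, map_zero, Pi.zero_apply]
  have h_denominators : nowhereZero u ≤ nonZeroDivisors (MvPolynomial T ℂ) := fun q hq =>
    mem_nonZeroDivisors_of_ne_zero (by
      rintro rfl
      exact (Pi.isUnit_iff.mp hq x₀).ne_zero (by simp))
  have : IsDomain (Localization (nowhereZero u)) :=
    IsLocalization.isDomain_localization h_denominators
  have h_trdeg : Algebra.trdeg ℂ (Localization (nowhereZero u)) ≤ (Fintype.card T : ℕ) := by
    have : FaithfulSMul (MvPolynomial T ℂ) (Localization (nowhereZero u)) :=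
      (faithfulSMul_iff_algebraMap_injective _ _).mpr (IsLocalization.injective _ h_denominators)
    have := IsLocalization.isAlgebraic (Localization (nowhereZero u)) (nowhereZero u)
    rw [← trdeg_add_eq ℂ (MvPolynomial T ℂ), trdeg_eq_zero (R := MvPolynomial T ℂ), add_zero,
      MvPolynomial.trdeg_of_isDomain]
    simp
  exact (ringKrullDim_le_of_surjective (Ideal.Quotient.factor ker_ψ)
    (Ideal.Quotient.factor_surjective _)).trans <|
      ringKrullDim_le_of_trdeg_le h_trdeg (Ideal.kerLiftAlg ψ) (Ideal.kerLiftAlg_injective ψ)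

/-- The families of power series over `X` all of whose coefficients are rational functions,
without poles, of the functions `u t`. -/
def rationalSeries (u : T → X → K) : Subalgebra K (X → PowerSeries K) where
  carrier := {F | ∀ m, (fun x => PowerSeries.coeff m (F x)) ∈ rationalFunctions u}
  mul_mem' {F G} hF hG m := by
    have : (fun x => PowerSeries.coeff m ((F * G) x)) =
        ∑ p ∈ antidiagonal m, (fun x => PowerSeries.coeff p.1 (F x)) *
          fun x => PowerSeries.coeff p.2 (G x) := by
      ext x
      simp [PowerSeries.coeff_mul]
    rw [this]
    exact sum_mem fun p _ => mul_mem (hF p.1) (hG p.2)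
  add_mem' hF hG m := by
    simp only [Pi.add_apply, map_add]
    exact add_mem (hF m) (hG m)
  algebraMap_mem' c m :=
    algebraMap_mem (rationalFunctions u) (PowerSeries.coeff m (PowerSeries.C c))

theorem inv_mem_rationalSeries {F : X → PowerSeries K} (hF : F ∈ rationalSeries u)
    (h0 : ∀ x, PowerSeries.constantCoeff (F x) ≠ 0) : (fun x => (F x)⁻¹) ∈ rationalSeries u := by
  intro m
  induction m using Nat.strong_induction_on with
  | _ m ih =>
    have h_inv : (fun x => PowerSeries.constantCoeff (F x))⁻¹ ∈ rationalFunctions u :=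
      inv_mem_rationalFunctions (by simpa using hF 0) h0
    rw [funext fun x => PowerSeries.coeff_inv m (F x)]
    split_ifs with hm
    · exact h_inv
    · have : (fun x => -(PowerSeries.constantCoeff (F x))⁻¹ * ∑ p ∈ antidiagonal m,
          if p.2 < m then PowerSeries.coeff p.1 (F x) * PowerSeries.coeff p.2 (F x)⁻¹ else 0) =
          -(fun x => PowerSeries.constantCoeff (F x))⁻¹ * ∑ p ∈ antidiagonal m,
            if p.2 < m then (fun x => PowerSeries.coeff p.1 (F x)) *
              fun x => PowerSeries.coeff p.2 (F x)⁻¹ else 0 := by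
        ext x
        simp only [Pi.mul_apply, Pi.neg_apply, Pi.inv_apply, Finset.sum_apply]
        congr! 2 with p
        split_ifs <;> rfl
      rw [this]
      refine mul_mem (neg_mem h_inv) (sum_mem fun p _ => ?_)
      split_ifs with hp
      · exact mul_mem (hF p.1) (ih p.2 hp)
      · exact zero_mem _

end Rational

section Mor

open Topology

variable {n d : ℕ}

theorem evalAt_apply (a : Coeffs n d) (v : Fin 2 → ℂ) (i : Fin (n + 1)) :
    evalAt a v i = ∑ j : Fin (d + 1), a (i, j) * (v 0 ^ (d - (j : ℕ)) * v 1 ^ (j : ℕ)) :=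
  rfl

theorem continuous_evalAt : Continuous fun p : Coeffs n d × (Fin 2 → ℂ) => evalAt p.1 p.2 := by
  refine continuous_pi fun i => ?_
  simp only [evalAt_apply]
  fun_prop

theorem evalAt_smul (a : Coeffs n d) (v : Fin 2 → ℂ) (c : ℂ) :
    evalAt a (c • v) = c ^ d • evalAt a v := by
  ext i
  simp only [evalAt_apply, Pi.smul_apply, smul_eq_mul, Finset.mul_sum]
  refine Finset.sum_congr rfl fun j _ => ?_
  rw [show c ^ d = c ^ (d - (j : ℕ)) * c ^ (j : ℕ) by rw [← pow_add, Nat.sub_add_cancel j.is_le]]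
  ring

theorem isOpen_Mor : IsOpen (Mor n d) := by
  have h_zero : {a : Coeffs n d | ∀ v : Fin 2 → ℂ, v ≠ 0 → evalAt a v ≠ 0} =
      {a | ∀ v ∈ Metric.sphere (0 : Fin 2 → ℂ) 1, evalAt a v ≠ 0} := by
    ext a
    refine ⟨fun h v hv => h v (Metric.ne_of_mem_sphere hv one_ne_zero), fun h v hv h0 => ?_⟩
    refine h (((‖v‖⁻¹ : ℝ) : ℂ) • v) ?_ (by rw [evalAt_smul, h0, smul_zero])
    simp [norm_smul, hv]
  have h_morphism : IsOpen {a : Coeffs n d | ∀ v : Fin 2 → ℂ, v ≠ 0 → evalAt a v ≠ 0} := by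
    rw [h_zero, isOpen_iff_mem_nhds]
    refine fun a ha => (isCompact_sphere _ _).eventually_forall_of_forall_eventually fun v hv => ?_
    exact continuous_evalAt.continuousAt.eventually_ne (ha v hv)
  have h_curry : Continuous fun (a : Coeffs n d) (i : Fin (n + 1)) (j : Fin (d + 1)) => a (i, j) :=
    by fun_prop
  exact h_morphism.inter (isOpen_setOfPred_linearIndependent.preimage h_curry)

theorem zariskiDim_Mor (h : (Mor n d).Nonempty) :
    zariskiDim (Mor n d) = ((n + 1) * (d + 1) : ℕ) := by
  simpa using zariskiDim_of_isOpen isOpen_Mor h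

end Mor

section Orders

open PowerSeries

variable {K : Type*} [Field K]

/-- The set of orders of the nonzero elements of a space of power series. -/
def orderSet (V : Submodule K (PowerSeries K)) : Set ℕ :=
  {m | ∃ f ∈ V, f.order = m}

theorem linearIndependent_of_injective_order {ι : Type*} {f : ι → PowerSeries K} {k : ι → ℕ}
    (hk : Function.Injective k) (hf : ∀ i, (f i).order = k i) : LinearIndependent K f := by
  classical
  refine linearIndependent_iff'.mpr fun s c hc => ?_
  by_contra! h
  obtain ⟨i, hi, h_min⟩ := (s.filter (c · ≠ 0)).exists_min_image k
    (by simpa [Finset.filter_nonempty_iff] using h)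
  rw [Finset.mem_filter] at hi
  have h_coeff : coeff (k i) (∑ j ∈ s, c j • f j) = c i * coeff (k i) (f i) := by
    rw [map_sum, Finset.sum_eq_single_of_mem i hi.1, coeff_smul, smul_eq_mul]
    intro j hj hji
    by_cases hcj : c j = 0
    · simp [hcj]
    · have hlt := (h_min j (Finset.mem_filter.mpr ⟨hj, hcj⟩)).lt_of_ne (hk.ne hji.symm)
      rw [coeff_smul, (order_eq_nat.mp (hf j)).2 _ hlt, smul_zero]
  rw [hc, map_zero] at h_coeff
  exact mul_ne_zero hi.2 (order_eq_nat.mp (hf i)).1 h_coeff.symm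

theorem eq_zero_of_coeff_orderSet {V : Submodule K (PowerSeries K)} {f : PowerSeries K}
    (hf : f ∈ V) (h : ∀ m ∈ orderSet V, coeff m f = 0) : f = 0 := by
  by_contra hne
  exact coeff_order hne (h _ ⟨f, hf, (coe_toNat_order hne).symm⟩)

theorem exists_strictMono_range_eq_orderSet (V : Submodule K (PowerSeries K))
    [FiniteDimensional K V] {n : ℕ} (hV : Module.finrank K V = n) :
    ∃ k : Fin n → ℕ, StrictMono k ∧ orderSet V = Set.range k := by
  choose f hf hf_order using fun m : orderSet V => m.2
  have f_indep : LinearIndependent K fun m => (⟨f m, hf m⟩ : V) :=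
    (linearIndependent_of_injective_order Subtype.val_injective hf_order).of_comp V.subtype
  have : Finite (orderSet V) := f_indep.finite
  have := Fintype.ofFinite (orderSet V)
  let coeffs : V →ₗ[K] orderSet V → K :=
    (LinearMap.pi fun m : orderSet V => coeff (R := K) (m : ℕ)) ∘ₗ V.subtype
  have coeffs_injective : Function.Injective coeffs :=
    (injective_iff_map_eq_zero _).mpr fun x hx =>
      Subtype.ext (eq_zero_of_coeff_orderSet x.2 fun m hm => congrFun hx ⟨m, hm⟩)
  have h_card : (orderSet V).toFinset.card = n := by
    rw [Set.toFinset_card, ← hV]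
    refine le_antisymm f_indep.fintype_card_le_finrank ?_
    simpa using LinearMap.finrank_le_finrank_of_injective coeffs_injective
  refine ⟨(orderSet V).toFinset.orderEmbOfFin h_card, OrderEmbedding.strictMono _, ?_⟩
  simp

theorem exists_echelonBasis {ι : Type*} [Fintype ι] [DecidableEq ι]
    {V : Submodule K (PowerSeries K)} [FiniteDimensional K V]
    (hV : Module.finrank K V = Fintype.card ι) {k : ι → ℕ} (hk : orderSet V = Set.range k) :
    ∃ G : ι → PowerSeries K, (∀ i, G i ∈ V) ∧
      (∀ i l, coeff (k l) (G i) = if l = i then 1 else 0) ∧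
      (∀ i, ∀ l < k i, coeff l (G i) = 0) ∧
      ∀ f ∈ V, f = ∑ l, coeff (k l) f • G l := by
  let coeffs : V →ₗ[K] ι → K := (LinearMap.pi fun l => coeff (R := K) (k l)) ∘ₗ V.subtype
  have coeffs_injective : Function.Injective coeffs :=
    (injective_iff_map_eq_zero _).mpr fun x hx =>
      Subtype.ext <| eq_zero_of_coeff_orderSet x.2 fun m hm => by
        obtain ⟨l, rfl⟩ := hk ▸ hm
        exact congrFun hx l
  let e : V ≃ₗ[K] ι → K := LinearEquiv.ofInjectiveOfFinrankEq coeffs coeffs_injective (by simpa)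
  let G (i : ι) : V := e.symm (Pi.single i 1)
  have hG (i l) : coeff (k l) (G i : PowerSeries K) = if l = i then 1 else 0 := by
    have := congrFun (e.apply_symm_apply (Pi.single i 1)) l
    rwa [Pi.single_apply] at this
  refine ⟨fun i => G i, fun i => (G i).2, hG, fun i l hl => ?_, fun f hf => ?_⟩
  · have hne : (G i : PowerSeries K) ≠ 0 := fun h0 => by simpa [h0] using hG i i
    obtain ⟨m, hm⟩ : (G i : PowerSeries K).order.toNat ∈ Set.range k :=
      hk ▸ ⟨_, (G i).2, (coe_toNat_order hne).symm⟩
    have hmi : m = i := by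
      by_contra hmi
      exact coeff_order hne (by rw [← hm, hG, if_neg hmi])
    exact coeff_of_lt_order_toNat _ (by rwa [← hm, hmi])
  · have h_sum := congrArg e.symm (pi_eq_sum_univ' (e ⟨f, hf⟩))
    simp only [map_sum, map_smul, LinearEquiv.symm_apply_apply] at h_sum
    exact (congrArg Subtype.val h_sum).trans (by rw [AddSubmonoidClass.coe_finsetSum]; rfl)

section Expand

variable {O : Subalgebra K (PowerSeries K)} {g : ℕ} {H : PowerSeries K}

theorem exists_X_pow_dvd_sub_smul_pow (h_odd : ∀ f ∈ O, ∀ r < g, f.order ≠ (2 * r + 1 : ℕ))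
    (hH : H ∈ O) (H_order : H.order = 2) {f : PowerSeries K} (hf : f ∈ O) {r : ℕ} (hr : r < g)
    (hfr : X ^ (2 * r) ∣ f) : ∃ q : K, X ^ (2 * (r + 1)) ∣ f - q • H ^ r := by
  have pow_order : (H ^ r).order = (2 * r : ℕ) := by
    rw [order_pow, H_order, nsmul_eq_mul, mul_comm]
    norm_cast
  obtain ⟨lead_ne, h_lt⟩ := order_eq_nat.mp pow_order
  set q := coeff (2 * r) f / coeff (2 * r) (H ^ r) with hq
  have h_low : ∀ l < 2 * r + 1, coeff l (f - q • H ^ r) = 0 := fun l hl => by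
    rw [map_sub, coeff_smul, smul_eq_mul]
    rcases Nat.lt_succ_iff_lt_or_eq.mp hl with h | rfl
    · rw [X_pow_dvd_iff.mp hfr l h, h_lt l h, mul_zero, sub_zero]
    · rw [hq, div_mul_cancel₀ _ lead_ne, sub_self]
  refine ⟨q, X_pow_dvd_iff.mpr fun l hl => ?_⟩
  rcases Nat.lt_or_ge l (2 * r + 1) with h | h
  · exact h_low l h
  · obtain rfl : l = 2 * r + 1 := by omega
    by_contra hne
    exact h_odd _ (sub_mem hf (O.smul_mem (pow_mem hH r) q)) r hr (order_eq_nat.mpr ⟨hne, h_low⟩)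

theorem exists_X_pow_dvd_sub_sum_pow (h_odd : ∀ f ∈ O, ∀ r < g, f.order ≠ (2 * r + 1 : ℕ))
    (hH : H ∈ O) (H_order : H.order = 2) {f : PowerSeries K} (hf : f ∈ O) :
    ∃ c : ℕ → K, X ^ (2 * g) ∣ f - ∑ j ∈ Finset.range g, c j • H ^ j := by
  suffices h : ∀ r ≤ g, ∃ c : ℕ → K, X ^ (2 * r) ∣ f - ∑ j ∈ Finset.range r, c j • H ^ j from
    h g le_rfl
  intro r hr
  induction r with
  | zero => exact ⟨0, by simp⟩
  | succ r ih =>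
    obtain ⟨c, hc⟩ := ih (by omega)
    obtain ⟨q, hq⟩ := exists_X_pow_dvd_sub_smul_pow h_odd hH H_order
      (sub_mem hf (sum_mem fun j _ => O.smul_mem (pow_mem hH j) (c j))) hr hc
    refine ⟨Function.update c r q, ?_⟩
    rw [Finset.sum_range_succ, Function.update_self, ← sub_sub,
      Finset.sum_congr rfl fun j hj => by
        rw [Function.update_of_ne (Finset.mem_range.mp hj).ne]]
    exact hq

end Expand

end Orders

section LocalGeometry

open PowerSeries

theorem even_or_le_of_mem_hyperellipticSemigroup {g m : ℕ} (h : m ∈ hyperellipticSemigroup g) :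
    Even m ∨ 2 * g + 1 ≤ m := by
  induction h using AddSubmonoid.closure_induction with
  | mem x hx => rcases hx with rfl | rfl <;> simp
  | zero => simp
  | add x y _ _ hx hy =>
    rcases hx with hx | hx
    · rcases hy with hy | hy
      · exact .inl (hx.add hy)
      · exact .inr (by omega)
    · exact .inr (by omega)

theorem X_pow_dvd_subst_sub_C {K ι : Type*} [Field K] {f : ι → PowerSeries K}
    (hf : MvPowerSeries.HasSubst f) {m : ℕ} (h_dvd : ∀ i, X ^ m ∣ f i) (h : MvPowerSeries ι K) :
    X ^ m ∣ (MvPowerSeries.subst f h : PowerSeries K) - C (MvPowerSeries.constantCoeff h) := by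
  refine X_pow_dvd_iff.mpr fun l hl => ?_
  have coeff_prod (e : ι →₀ ℕ) (he : e ≠ 0) :
      coeff l (e.prod fun i r => f i ^ r : PowerSeries K) = 0 := by
    obtain ⟨i, hi⟩ := Finsupp.support_nonempty_iff.mpr he
    have dvd_factor : X ^ m ∣ f i ^ e i :=
      (h_dvd i).trans (dvd_pow_self _ (Finsupp.mem_support_iff.mp hi))
    exact X_pow_dvd_iff.mp (dvd_factor.trans (Finset.dvd_prod_of_mem (fun i => f i ^ e i) hi)) l hl
  have coeff_subst : coeff l (MvPowerSeries.subst f h : PowerSeries K) =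
      MvPowerSeries.coeff 0 h • coeff l (1 : PowerSeries K) := by
    refine (MvPowerSeries.coeff_subst hf h _).trans (finsum_eq_single _ 0 fun e he => ?_)
    exact (congrArg _ (coeff_prod e he)).trans (smul_zero _)
  rw [map_sub, coeff_subst, coeff_one, coeff_C, MvPowerSeries.coeff_zero_eq_constantCoeff_apply]
  split_ifs <;> simp

variable {n d g : ℕ} {a : Coeffs n d} {v w : Fin 2 → ℂ} {j : Fin (n + 1)}

theorem constantCoeff_expansion (i : Fin (n + 1)) :
    constantCoeff (expansion a v w i) = evalAt a v i := by
  simp [expansion, evalAt, formAt]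

theorem constantCoeff_localCoord (i : Fin n) : constantCoeff (localCoord a v w j i) = 0 := by
  simp [localCoord]

theorem X_pow_dvd_localHom_sub_C {m : ℕ} (h_dvd : ∀ i, X ^ m ∣ localCoord a v w j i)
    (h : MvPowerSeries (Fin n) ℂ) :
    X ^ m ∣ localHom a v w j h - C (MvPowerSeries.constantCoeff h) := by
  rw [localHom, MvPowerSeries.coe_substAlgHom]
  exact X_pow_dvd_subst_sub_C (hasSubst_localCoord a v w j) h_dvd h

theorem constantCoeff_localHom (h : MvPowerSeries (Fin n) ℂ) :
    constantCoeff (localHom a v w j h) = MvPowerSeries.constantCoeff h := by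
  have := X_pow_dvd_localHom_sub_C (a := a) (v := v) (w := w) (j := j) (m := 1)
    (fun i => by rw [pow_one, X_dvd_iff, constantCoeff_localCoord]) h
  rwa [pow_one, X_dvd_iff, map_sub, constantCoeff_C, sub_eq_zero] at this

theorem inv_mem_range_localHom {f : PowerSeries ℂ} (hf : f ∈ (localHom a v w j).range)
    (h0 : constantCoeff f ≠ 0) : f⁻¹ ∈ (localHom a v w j).range := by
  obtain ⟨h, rfl⟩ := hf
  change constantCoeff (localHom a v w j h) ≠ 0 at h0
  refine ⟨h⁻¹, (PowerSeries.eq_inv_iff_mul_eq_one h0).mpr ?_⟩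
  change localHom a v w j h⁻¹ * localHom a v w j h = 1
  rw [← map_mul, MvPowerSeries.inv_mul_cancel _ (constantCoeff_localHom h ▸ h0), map_one]

theorem localCoord_mem_range (i : Fin n) : localCoord a v w j i ∈ (localHom a v w j).range := by
  refine ⟨MvPowerSeries.X i, ?_⟩
  change localHom a v w j (MvPowerSeries.X i) = _
  rw [localHom, MvPowerSeries.coe_substAlgHom, MvPowerSeries.subst_X (hasSubst_localCoord a v w j)]

theorem IsLocalChart.constantCoeff_ne_zero (h : IsLocalChart a v w j) :
    constantCoeff (expansion a v w j) ≠ 0 :=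
  constantCoeff_expansion j ▸ h.2

theorem IsLocalChart.localSection_self (h : IsLocalChart a v w j) : localSection a v w j j = 1 :=
  PowerSeries.mul_inv_cancel _ h.constantCoeff_ne_zero

theorem IsLocalChart.mul_localSection (h : IsLocalChart a v w j) (i : Fin (n + 1)) :
    expansion a v w j * localSection a v w j i = expansion a v w i := by
  rw [localSection, mul_left_comm, PowerSeries.mul_inv_cancel _ h.constantCoeff_ne_zero, mul_one]

theorem IsLocalChart.localSection_mem_range (h : IsLocalChart a v w j) (i : Fin (n + 1)) :
    localSection a v w j i ∈ (localHom a v w j).range := by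
  rcases Fin.eq_self_or_eq_succAbove j i with rfl | ⟨i, rfl⟩
  · exact h.localSection_self ▸ one_mem _
  · rw [← sub_add_cancel (localSection a v w j (j.succAbove i))
      (C (constantCoeff (localSection a v w j (j.succAbove i))))]
    exact add_mem (localCoord_mem_range i) (Subalgebra.algebraMap_mem _ _)

theorem mem_vanishingOrders_iff {m : ℕ} : m ∈ vanishingOrders a v w j ↔
    ∃ f ∈ Submodule.span ℂ (Set.range (localSection a v w j)), f.order = m := by
  simp only [vanishingOrders, Submodule.mem_span_range_iff_exists_fun, Set.mem_ofPred_eq,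
    exists_exists_eq_and]

theorem IsLocalChart.vanishingOrders_eq_orderSet (h : IsLocalChart a v w j) :
    vanishingOrders a v w j = orderSet (Submodule.span ℂ (Set.range (expansion a v w))) := by
  have order_sum (c : Fin (n + 1) → ℂ) : (∑ i, c i • expansion a v w i).order =
      (∑ i, c i • localSection a v w j i).order := by
    have : ∑ i, c i • expansion a v w i =
        expansion a v w j * ∑ i, c i • localSection a v w j i := by
      simp_rw [Finset.mul_sum, mul_smul_comm, h.mul_localSection]
    have expansion_isUnit := isUnit_iff_constantCoeff.mpr h.constantCoeff_ne_zero.isUnit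
    rw [this, order_mul, order_zero_of_unit expansion_isUnit, zero_add]
  ext m
  simp only [vanishingOrders, orderSet, Submodule.mem_span_range_iff_exists_fun, Set.mem_ofPred_eq,
    exists_exists_eq_and, order_sum]

theorem IsLocalChart.mul_inv_mem_range (h : IsLocalChart a v w j) {f f₀ : PowerSeries ℂ}
    (hf : f ∈ Submodule.span ℂ (Set.range (expansion a v w)))
    (hf₀ : f₀ ∈ Submodule.span ℂ (Set.range (expansion a v w))) (h0 : constantCoeff f₀ ≠ 0) :
    f * f₀⁻¹ ∈ (localHom a v w j).range := by
  have exists_factor {f : PowerSeries ℂ}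
      (hf : f ∈ Submodule.span ℂ (Set.range (expansion a v w))) :
      ∃ s ∈ (localHom a v w j).range, f = expansion a v w j * s := by
    obtain ⟨c, rfl⟩ := (Submodule.mem_span_range_iff_exists_fun ℂ).mp hf
    refine ⟨∑ i, c i • localSection a v w j i,
      sum_mem fun i _ => Subalgebra.smul_mem _ (h.localSection_mem_range i) _, ?_⟩
    simp_rw [Finset.mul_sum, mul_smul_comm, h.mul_localSection]
  obtain ⟨s, hs, rfl⟩ := exists_factor hf
  obtain ⟨s₀, hs₀, rfl⟩ := exists_factor hf₀
  have hs₀_ne : constantCoeff s₀ ≠ 0 := fun hs₀_eq => h0 (by rw [map_mul, hs₀_eq, mul_zero])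
  have : expansion a v w j * s * (expansion a v w j * s₀)⁻¹ = s * s₀⁻¹ := by
    rw [PowerSeries.mul_inv_rev]
    calc _ = s * s₀⁻¹ * (expansion a v w j * (expansion a v w j)⁻¹) := by ring
      _ = s * s₀⁻¹ := by
        rw [PowerSeries.mul_inv_cancel _ h.constantCoeff_ne_zero, mul_one]
  exact this ▸ mul_mem hs (inv_mem_range_localHom hs₀ hs₀_ne)

/-- The image of `[v]` is a unibranch point with value semigroup `⟨2, 2g + 1⟩`. The other points
of the image are not restricted. -/
structure IsHyperellipticCusp (g : ℕ) (a : Coeffs n d) (v w : Fin 2 → ℂ) (j : Fin (n + 1)) :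
    Prop where
  chart : IsLocalChart a v w j
  valueSemigroup_eq : valueSemigroup a v w j = hyperellipticSemigroup g

namespace IsHyperellipticCusp

theorem order_ne_of_mem_range (h : IsHyperellipticCusp g a v w j) :
    ∀ f ∈ (localHom a v w j).range, ∀ r < g, f.order ≠ (2 * r + 1 : ℕ) := by
  rintro _ ⟨x, rfl⟩ r hr h_order
  have h_mem : 2 * r + 1 ∈ valueSemigroup a v w j := ⟨x, h_order⟩
  rw [h.valueSemigroup_eq] at h_mem
  rcases even_or_le_of_mem_hyperellipticSemigroup h_mem with h_even | h_le
  · exact Nat.not_even_two_mul_add_one r h_even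
  · omega

theorem even_or_le_of_mem_vanishingOrders (h : IsHyperellipticCusp g a v w j) {m : ℕ}
    (hm : m ∈ vanishingOrders a v w j) : Even m ∨ 2 * g + 1 ≤ m := by
  obtain ⟨c, hc⟩ := hm
  obtain ⟨x, hx⟩ : ∑ i, c i • localSection a v w j i ∈ (localHom a v w j).range :=
    sum_mem fun i _ => Subalgebra.smul_mem _ (h.chart.localSection_mem_range i) _
  exact even_or_le_of_mem_hyperellipticSemigroup (h.valueSemigroup_eq ▸ ⟨x, hx ▸ hc⟩)

theorem zero_mem_vanishingOrders (h : IsHyperellipticCusp g a v w j) :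
    0 ∈ vanishingOrders a v w j := by
  refine mem_vanishingOrders_iff.mpr ⟨1, ?_, order_one⟩
  exact h.chart.localSection_self ▸ Submodule.subset_span ⟨j, rfl⟩

theorem two_mem_vanishingOrders (hg : 0 < g) (h : IsHyperellipticCusp g a v w j) :
    2 ∈ vanishingOrders a v w j := by
  by_contra h2
  have localCoord_mem (i : Fin n) :
      localCoord a v w j i ∈ Submodule.span ℂ (Set.range (localSection a v w j)) := by
    refine sub_mem (Submodule.subset_span ⟨_, rfl⟩) ?_
    rw [← mul_one (C _), ← smul_eq_C_mul, ← h.chart.localSection_self]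
    exact Submodule.smul_mem _ _ (Submodule.subset_span ⟨j, rfl⟩)
  have X_pow_dvd (i : Fin n) : X ^ 3 ∣ localCoord a v w j i := by
    have h0 : coeff 0 (localCoord a v w j i) = 0 := by
      rw [coeff_zero_eq_constantCoeff_apply, constantCoeff_localCoord]
    have h1 : coeff 1 (localCoord a v w j i) = 0 := by
      by_contra hne
      refine h.order_ne_of_mem_range _ (localCoord_mem_range i) 0 hg
        (order_eq_nat.mpr ⟨hne, fun l hl => ?_⟩)
      rwa [Nat.lt_one_iff.mp hl]
    refine X_pow_dvd_iff.mpr fun l hl => ?_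
    interval_cases l
    · exact h0
    · exact h1
    · by_contra hne
      refine h2 (mem_vanishingOrders_iff.mpr
        ⟨_, localCoord_mem i, order_eq_nat.mpr ⟨hne, fun l hl => ?_⟩⟩)
      interval_cases l <;> assumption
  obtain ⟨x, hx⟩ : 2 ∈ valueSemigroup a v w j :=
    h.valueSemigroup_eq ▸ AddSubmonoid.subset_closure (.inl rfl)
  refine (order_eq_nat.mp hx).1 ?_
  have := X_pow_dvd_iff.mp (X_pow_dvd_localHom_sub_C X_pow_dvd x) 2 (by norm_num)
  rwa [map_sub, coeff_C, if_neg two_ne_zero, sub_zero] at this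

end IsHyperellipticCusp

end LocalGeometry

section ChangeOfParameter

open PowerSeries

section Subst

variable {K : Type*} [Field K] {τ : PowerSeries K} (hτ : τ.order = 1)
include hτ

theorem hasSubst_of_order_eq_one : HasSubst τ :=
  HasSubst.of_constantCoeff_zero' <|
    order_ne_zero_iff_constCoeff_eq_zero.mp (hτ ▸ one_ne_zero)

theorem constantCoeff_subst_of_order_eq_one (f : PowerSeries K) :
    constantCoeff (f.subst τ : PowerSeries K) = constantCoeff f := by
  have hs := hasSubst_of_order_eq_one hτ
  have h0 : constantCoeff τ = 0 := order_ne_zero_iff_constCoeff_eq_zero.mp (hτ ▸ one_ne_zero)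
  rw [← coe_substAlgHom hs]
  conv_lhs => rw [eq_X_mul_shift_add_const f]
  have map_C : substAlgHom hs (C (constantCoeff f)) = C (constantCoeff f) :=
    (substAlgHom hs).commutes _
  rw [map_add, map_mul, substAlgHom_X, map_C, map_add, map_mul, h0, zero_mul, zero_add,
    constantCoeff_C]

theorem order_subst_of_order_eq_one (f : PowerSeries K) :
    order (f.subst τ : PowerSeries K) = f.order := by
  have hs := hasSubst_of_order_eq_one hτ
  rcases eq_or_ne f 0 with rfl | hf
  · rw [← coe_substAlgHom hs, map_zero]
  have order_unit : order ((divXPowOrder f).subst τ : PowerSeries K) = 0 := by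
    refine order_zero_of_unit (isUnit_iff_constantCoeff.mpr (isUnit_iff_ne_zero.mpr ?_))
    rw [constantCoeff_subst_of_order_eq_one hτ, constantCoeff_divXPowOrder]
    exact coeff_order hf
  conv_lhs => rw [← X_pow_order_mul_divXPowOrder (f := f)]
  rw [subst_mul hs, subst_pow hs, subst_X hs, PowerSeries.order_mul, order_pow, hτ, order_unit]
  simp [coe_toNat_order hf]

end Subst

variable {n d d' g : ℕ} {a : Coeffs n d} {a' : Coeffs n d'} {v w v' w' : Fin 2 → ℂ}
  {j : Fin (n + 1)}

section Reparametrization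

variable {τ κ : PowerSeries ℂ} (hτ : τ.order = 1) (hκ : constantCoeff κ ≠ 0)
  (h_exp : ∀ i, expansion a' v' w' i = κ * (expansion a v w i).subst τ)
include hτ h_exp

theorem evalAt_eq_mul_of_expansion_eq (i : Fin (n + 1)) :
    evalAt a' v' i = constantCoeff κ * evalAt a v i := by
  rw [← constantCoeff_expansion (w := w'), h_exp, map_mul,
    constantCoeff_subst_of_order_eq_one hτ, constantCoeff_expansion]

include hκ

theorem localSection_eq_subst (h : IsLocalChart a v w j) (i : Fin (n + 1)) :
    localSection a' v' w' j i = (localSection a v w j i).subst τ := by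
  have hs := hasSubst_of_order_eq_one hτ
  have unit' : constantCoeff (expansion a' v' w' j) ≠ 0 := by
    rw [constantCoeff_expansion, evalAt_eq_mul_of_expansion_eq hτ h_exp]
    exact mul_ne_zero hκ h.2
  rw [localSection, eq_comm, PowerSeries.eq_mul_inv_iff_mul_eq unit', h_exp, h_exp,
    mul_left_comm, ← subst_mul hs, mul_comm (localSection a v w j i), h.mul_localSection]

theorem localCoord_eq_subst (h : IsLocalChart a v w j) (i : Fin n) :
    localCoord a' v' w' j i = (localCoord a v w j i).subst τ := by
  have hs := hasSubst_of_order_eq_one hτ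
  rw [localCoord, localCoord, subst_sub hs, localSection_eq_subst hτ hκ h_exp h,
    constantCoeff_subst_of_order_eq_one hτ]
  congr 1
  rw [← coe_substAlgHom hs]
  exact ((substAlgHom hs).commutes _).symm

theorem valueSemigroup_eq_of_expansion_eq (h : IsLocalChart a v w j) :
    valueSemigroup a' v' w' j = valueSemigroup a v w j := by
  have hs := hasSubst_of_order_eq_one hτ
  have localHom_eq (f : MvPowerSeries (Fin n) ℂ) :
      localHom a' v' w' j f = (localHom a v w j f).subst τ := by
    rw [localHom, localHom, MvPowerSeries.coe_substAlgHom, MvPowerSeries.coe_substAlgHom,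
      funext (localCoord_eq_subst hτ hκ h_exp h)]
    exact (MvPowerSeries.subst_comp_subst_apply (hasSubst_localCoord a v w j) hs.const f).symm
  simp only [valueSemigroup, localHom_eq, order_subst_of_order_eq_one hτ]

theorem vanishingOrders_eq_of_expansion_eq (h : IsLocalChart a v w j) :
    vanishingOrders a' v' w' j = vanishingOrders a v w j := by
  have hs := hasSubst_of_order_eq_one hτ
  have order_sum (c : Fin (n + 1) → ℂ) : (∑ i, c i • localSection a' v' w' j i).order =
      (∑ i, c i • localSection a v w j i).order := by
    have : ∑ i, c i • localSection a' v' w' j i =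
        (∑ i, c i • localSection a v w j i).subst τ := by
      simp_rw [localSection_eq_subst hτ hκ h_exp h, ← coe_substAlgHom hs, map_sum, map_smul]
    rw [this, order_subst_of_order_eq_one hτ]
  simp only [vanishingOrders, order_sum]

theorem IsHyperellipticCusp.of_expansion_eq (h_det : v' 0 * w' 1 - v' 1 * w' 0 ≠ 0)
    (h : IsHyperellipticCusp g a v w j) : IsHyperellipticCusp g a' v' w' j where
  chart := ⟨h_det, by
    rw [evalAt_eq_mul_of_expansion_eq hτ h_exp]; exact mul_ne_zero hκ h.chart.2⟩
  valueSemigroup_eq :=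
    (valueSemigroup_eq_of_expansion_eq hτ hκ h_exp h.chart).trans h.valueSemigroup_eq

end Reparametrization

theorem map_formAt {A B : Type} [CommRing A] [Algebra ℂ A] [CommRing B] [Algebra ℂ B]
    (φ : A →ₐ[ℂ] B) (i : Fin (n + 1)) (x y : A) :
    φ (formAt a i x y) = formAt a i (φ x) (φ y) := by
  simp [formAt]

theorem formAt_mul {A : Type} [CommRing A] [Algebra ℂ A] (i : Fin (n + 1)) (c x y : A) :
    formAt a i (c * x) (c * y) = c ^ d * formAt a i x y := by
  simp only [formAt, Finset.mul_sum]
  refine Finset.sum_congr rfl fun j _ => ?_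
  have : c ^ d = c ^ (d - (j : ℕ)) * c ^ (j : ℕ) := by
    rw [← pow_add, Nat.sub_add_cancel j.is_le]
  rw [mul_smul_comm, this, mul_pow, mul_pow, mul_mul_mul_comm]

theorem formAt_rev {A : Type} [CommRing A] [Algebra ℂ A] (i : Fin (n + 1)) (x y : A) :
    formAt (fun p : Fin (n + 1) × Fin (d + 1) => a (p.1, p.2.rev)) i y x = formAt a i x y := by
  refine Fintype.sum_equiv Fin.revPerm _ _ fun j => ?_
  have h_rev : d - (j.rev : ℕ) = j := by rw [Fin.val_rev]; omega
  have h_rev' : (j.rev : ℕ) = d - j := by rw [Fin.val_rev]; omega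
  rw [Fin.revPerm_apply, h_rev, h_rev', mul_comm]

/-- The new basis corresponds to the new local parameter `t X / (r + s X)`. -/
theorem exists_expansion_smul_add_eq {r s t : ℂ} (hr : r ≠ 0) (ht : t ≠ 0) :
    ∃ τ κ : PowerSeries ℂ, τ.order = 1 ∧ constantCoeff κ ≠ 0 ∧
      ∀ i, expansion a (r • v) (s • v + t • w) i = κ * (expansion a v w i).subst τ := by
  set κ : PowerSeries ℂ := C r + C s * X with κ_def
  have hκ : constantCoeff κ ≠ 0 := by simpa [κ] using hr
  set τ : PowerSeries ℂ := C t * X * κ⁻¹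
  have hτ : τ.order = 1 := by
    rw [order_mul, order_mul, order_X, order_zero_of_unit, order_zero_of_unit, zero_add, add_zero]
    · exact isUnit_iff_constantCoeff.mpr (by simpa using hκ)
    · exact isUnit_iff_constantCoeff.mpr (by simpa using ht)
  have κ_mul_τ : κ * τ = C t * X := by
    rw [mul_left_comm, PowerSeries.mul_inv_cancel _ hκ, mul_one]
  have hs := hasSubst_of_order_eq_one hτ
  refine ⟨τ, κ ^ d, hτ, by simpa only [map_pow] using pow_ne_zero d hκ, fun i => ?_⟩
  have map_C (c : ℂ) : substAlgHom hs (C c) = C c := (substAlgHom hs).commutes _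
  have map_coord (l : Fin 2) : κ * substAlgHom hs (C (v l) + C (w l) * X) =
      C ((r • v) l) + C ((s • v + t • w) l) * X := by
    simp only [map_add, map_mul, map_C, substAlgHom_X, Pi.smul_apply, Pi.add_apply, smul_eq_mul,
      mul_add]
    rw [mul_left_comm κ, κ_mul_τ, κ_def]
    ring
  rw [expansion, expansion, ← coe_substAlgHom hs, map_formAt, ← formAt_mul, map_coord, map_coord]

theorem expansion_rev (i : Fin (n + 1)) :
    expansion (fun p : Fin (n + 1) × Fin (d + 1) => a (p.1, p.2.rev)) (v ∘ Fin.rev) (w ∘ Fin.rev) i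
      = expansion a v w i :=
  formAt_rev i _ _

theorem IsHyperellipticCusp.exists_normalized_of_ne_zero (h : IsHyperellipticCusp g a v w j)
    (hv : v 0 ≠ 0) : ∃ θ : ℂ, IsHyperellipticCusp g a ![1, θ] ![0, 1] j ∧
      vanishingOrders a ![1, θ] ![0, 1] j = vanishingOrders a v w j := by
  have h_det := h.chart.1
  set D := v 0 * w 1 - v 1 * w 0 with D_def
  have v_eq : (v 0)⁻¹ • v = ![1, v 1 / v 0] := by
    ext l; fin_cases l
    · simp [hv]
    · simp [div_eq_inv_mul]
  have w_eq : (-(w 0 / D)) • v + (v 0 / D) • w = ![0, 1] := by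
    ext l; fin_cases l
    · simp; ring
    · simp; field_simp; rw [D_def]; ring
  obtain ⟨τ, κ, hτ, hκ, h_exp⟩ := exists_expansion_smul_add_eq (a := a) (v := v) (w := w)
    (r := (v 0)⁻¹) (s := -(w 0 / D)) (inv_ne_zero hv) (div_ne_zero hv h_det)
  rw [v_eq, w_eq] at h_exp
  exact ⟨v 1 / v 0, h.of_expansion_eq hτ hκ h_exp (by simp),
    vanishingOrders_eq_of_expansion_eq hτ hκ h_exp h.chart⟩

/-- Exchanging the two coordinates of `ℙ¹` moves the cusp away from the point at infinity. -/
theorem IsHyperellipticCusp.exists_normalized (h : IsHyperellipticCusp g a v w j) :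
    ∃ (e : Equiv.Perm (Fin (d + 1))) (θ : ℂ),
      IsHyperellipticCusp g (fun p => a (p.1, e p.2)) ![1, θ] ![0, 1] j ∧
      vanishingOrders (fun p => a (p.1, e p.2)) ![1, θ] ![0, 1] j = vanishingOrders a v w j := by
  by_cases hv : v 0 = 0
  · have hv1 : v 1 ≠ 0 := fun hv1 => h.chart.1 (by simp [hv, hv1])
    have h_exp (i : Fin (n + 1)) : expansion (fun p : Fin (n + 1) × Fin (d + 1) => a (p.1, p.2.rev))
        (v ∘ Fin.rev) (w ∘ Fin.rev) i = 1 * (expansion a v w i).subst X := by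
      rw [X_subst, one_mul, expansion_rev]
    have h_det : v 1 * w 0 - v 0 * w 1 ≠ 0 := fun h0 => h.chart.1 (by linear_combination -h0)
    have h_rev := h.of_expansion_eq order_X (by simp) h_exp h_det
    obtain ⟨θ, hθ, h_orders⟩ := h_rev.exists_normalized_of_ne_zero hv1
    exact ⟨Fin.revPerm, θ, hθ,
      h_orders.trans (vanishingOrders_eq_of_expansion_eq order_X (by simp) h_exp h.chart)⟩
  · exact ⟨1, h.exists_normalized_of_ne_zero hv⟩

end ChangeOfParameter

section FormCoeffs

open PowerSeries

/-- The coefficients of the binary form of degree `d` whose expansion with respect to the basis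
`(1, θ)`, `(0, 1)` is the given power series, truncated after `X ^ d`. The map inverts
`a ↦ expansion a ![1, θ] ![0, 1]`. -/
def formCoeffs (d : ℕ) (θ : ℂ) : PowerSeries ℂ →ₗ[ℂ] (Fin (d + 1) → ℂ) :=
  LinearMap.pi fun j =>
    ∑ l ∈ Finset.range (d + 1), ((l.choose j : ℂ) * (-θ) ^ (l - (j : ℕ))) • coeff l

variable {n d : ℕ} {a : Coeffs n d} {θ : ℂ}

theorem formCoeffs_apply (f : PowerSeries ℂ) (j : Fin (d + 1)) : formCoeffs d θ f j =
    ∑ l ∈ Finset.range (d + 1), (l.choose j : ℂ) * (-θ) ^ (l - (j : ℕ)) * coeff l f := by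
  simp [formCoeffs]

theorem formCoeffs_coe_taylor {p : Polynomial ℂ} (hp : p.natDegree < d + 1) (j : Fin (d + 1)) :
    formCoeffs d θ (Polynomial.taylor θ p : Polynomial ℂ) j = p.coeff j := by
  have sum_taylor := Polynomial.sum_taylor_eq p θ
  rw [Polynomial.sum_over_range' _ (by simp) (d + 1) (by rwa [Polynomial.natDegree_taylor])]
    at sum_taylor
  conv_rhs => rw [← sum_taylor, Polynomial.finsetSum_coeff]
  rw [formCoeffs_apply]
  refine Finset.sum_congr rfl fun l _ => ?_
  rw [Polynomial.coeff_C_mul, sub_eq_add_neg, ← map_neg, Polynomial.coeff_X_add_C_pow,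
    Polynomial.coeff_coe]
  ring

theorem expansion_eq_coe_taylor (i : Fin (n + 1)) : expansion a ![1, θ] ![0, 1] i =
    (Polynomial.taylor θ (Polynomial.ofFn (d + 1) fun j => a (i, j)) : Polynomial ℂ) := by
  simp only [Polynomial.ofFn_eq_sum_monomial, expansion, formAt, map_sum,
    Polynomial.taylor_monomial]
  rw [← Polynomial.coeToPowerSeries.ringHom_apply, map_sum]
  refine Finset.sum_congr rfl fun j _ => ?_
  simp [smul_eq_C_mul, add_comm]

theorem formCoeffs_expansion (i : Fin (n + 1)) (j : Fin (d + 1)) :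
    formCoeffs d θ (expansion a ![1, θ] ![0, 1] i) j = a (i, j) := by
  rw [expansion_eq_coe_taylor,
    formCoeffs_coe_taylor (Polynomial.ofFn_natDegree_lt d.succ_pos _),
    Polynomial.ofFn_coeff_eq_val_of_lt _ j.is_lt]

theorem coeff_expansion_eq_zero {l : ℕ} (hl : d < l) (i : Fin (n + 1)) :
    coeff l (expansion a ![1, θ] ![0, 1] i) = 0 := by
  rw [expansion_eq_coe_taylor, Polynomial.coeff_coe]
  refine Polynomial.coeff_eq_zero_of_natDegree_lt ?_
  rw [Polynomial.natDegree_taylor]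
  exact (Polynomial.ofFn_natDegree_lt d.succ_pos _).trans_le hl

theorem linearIndependent_comp_perm (e : Equiv.Perm (Fin (d + 1)))
    (ha : LinearIndependent ℂ fun i j => a (i, j)) :
    LinearIndependent ℂ fun i j => a (i, e j) :=
  ha.map' (LinearMap.funLeft ℂ ℂ e)
    (LinearMap.ker_eq_bot.mpr (LinearMap.funLeft_injective_of_surjective ℂ ℂ e e.surjective))

theorem linearIndependent_expansion (ha : LinearIndependent ℂ fun i j => a (i, j)) :
    LinearIndependent ℂ (expansion a ![1, θ] ![0, 1]) := by
  refine LinearIndependent.of_comp (formCoeffs d θ) ?_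
  rwa [show formCoeffs d θ ∘ expansion a ![1, θ] ![0, 1] = fun i j => a (i, j) from
    funext₂ formCoeffs_expansion]

end FormCoeffs

section PowerSection

open PowerSeries

theorem coeff_mul_pow_eq {R : Type*} [CommRing R] {Q V : PowerSeries R} {r : ℕ} (hr : 0 < r)
    (hQ : constantCoeff Q = 1) (hV : constantCoeff V = 1) (j : ℕ) : coeff r (Q * V ^ j) =
      coeff r (Q * ((trunc r V : Polynomial R) : PowerSeries R) ^ j) + j * coeff r V := by
  set Y : PowerSeries R := ((trunc r V : Polynomial R) : PowerSeries R)
  set Z : PowerSeries R := mk fun s => coeff (s + r) V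
  have V_eq : V = Y + X ^ r * Z := (eq_X_pow_mul_shift_add_trunc r V).trans (add_comm _ _)
  have hY : constantCoeff Y = 1 := by
    rw [← coeff_zero_eq_constantCoeff_apply, Polynomial.coeff_coe, coeff_trunc, if_pos hr,
      coeff_zero_eq_constantCoeff_apply, hV]
  have hZ : constantCoeff Z = coeff r V := by
    rw [← coeff_zero_eq_constantCoeff_apply, coeff_mk, zero_add]
  obtain ⟨B, hB⟩ := Polynomial.powAddExpansion Y (X ^ r * Z) j
  have : Q * V ^ j = Q * Y ^ j +
      X ^ r * (Q * ((j : PowerSeries R) * Y ^ (j - 1)) * Z + X ^ r * (Q * B * Z ^ 2)) := by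
    rw [V_eq, hB]
    ring
  rw [this, map_add, coeff_X_pow_mul', if_pos le_rfl, Nat.sub_self,
    coeff_zero_eq_constantCoeff_apply]
  have : constantCoeff (X ^ r : PowerSeries R) = 0 := by simp [hr.ne']
  simp [hQ, hY, hZ, this]

variable {K S T : Type*} [Field K] {u : T → S → K}

theorem coeff_mem_rationalFunctions_of_coeff_mul_pow {Q V : S → PowerSeries K} {r j : ℕ}
    (hr : 0 < r) (hj : (j : K) ≠ 0) (hQ : Q ∈ rationalSeries u)
    (hQ₁ : ∀ x, constantCoeff (Q x) = 1) (hV₁ : ∀ x, constantCoeff (V x) = 1)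
    (h_lt : ∀ s < r, (fun x => coeff s (V x)) ∈ rationalFunctions u)
    (h_mul : (fun x => coeff r (Q x * V x ^ j)) ∈ rationalFunctions u) :
    (fun x => coeff r (V x)) ∈ rationalFunctions u := by
  have trunc_mem :
      (fun x => ((trunc r (V x) : Polynomial K) : PowerSeries K)) ∈ rationalSeries u := by
    intro s
    simp only [Polynomial.coeff_coe, coeff_trunc]
    split_ifs with hs
    · exact h_lt s hs
    · exact zero_mem _
  have : (fun x => coeff r (V x)) = (j : K)⁻¹ • ((fun x => coeff r (Q x * V x ^ j)) -
      fun x => coeff r (Q x * ((trunc r (V x) : Polynomial K) : PowerSeries K) ^ j)) := by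
    ext x
    simp only [Pi.smul_apply, Pi.sub_apply, smul_eq_mul]
    rw [coeff_mul_pow_eq hr (hQ₁ x) (hV₁ x), add_sub_cancel_left, inv_mul_cancel_left₀ hj]
  rw [this]
  exact Subalgebra.smul_mem _ (sub_mem h_mul (mul_mem hQ (pow_mem trunc_mem j) r)) _

/-- The section `s₀ * (s₁ / s₀) ^ j` attached to the `j`-th power of the affine coordinate
`s₁ / s₀`, where `s₀` and `s₁` are the local expansions of two sections of a line bundle. -/
def powerSection (s₀ s₁ : PowerSeries K) (j : ℕ) : PowerSeries K :=
  s₀ * (s₁ * s₀⁻¹) ^ j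

variable {s₀ s₁ : PowerSeries K}

theorem powerSection_eq_X_pow_mul (h_low : ∀ l < 2, coeff l s₁ = 0) (j : ℕ) :
    powerSection s₀ s₁ j =
      X ^ (2 * j) * (s₀ * s₀⁻¹ ^ j * (mk fun l => coeff (l + 2) s₁) ^ j) := by
  obtain ⟨V, rfl⟩ := X_pow_dvd_iff.mpr h_low
  have : (mk fun l => coeff (l + 2) (X ^ 2 * V)) = V := by
    ext l
    rw [coeff_mk, coeff_X_pow_mul]
  rw [this, powerSection, pow_mul]
  ring

theorem coeff_powerSection_of_lt (h_low : ∀ l < 2, coeff l s₁ = 0) {j l : ℕ} (hl : l < 2 * j) :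
    coeff l (powerSection s₀ s₁ j) = 0 := by
  rw [powerSection_eq_X_pow_mul h_low, coeff_X_pow_mul', if_neg hl.not_ge]

theorem coeff_powerSection_self (h₀ : constantCoeff s₀ = 1) (h_low : ∀ l < 2, coeff l s₁ = 0)
    (h₁ : coeff 2 s₁ = 1) (j : ℕ) : coeff (2 * j) (powerSection s₀ s₁ j) = 1 := by
  rw [powerSection_eq_X_pow_mul h_low, coeff_X_pow_mul', if_pos le_rfl, Nat.sub_self,
    coeff_zero_eq_constantCoeff_apply]
  simp [h₀, h₁]

theorem powerSection_mem_rationalSeries {s₀ s₁ : S → PowerSeries K}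
    (hs₀ : s₀ ∈ rationalSeries u) (hs₁ : s₁ ∈ rationalSeries u)
    (h0 : ∀ x, constantCoeff (s₀ x) ≠ 0) (j : ℕ) :
    (fun x => powerSection (s₀ x) (s₁ x) j) ∈ rationalSeries u :=
  mul_mem hs₀ (pow_mem (mul_mem hs₁ (inv_mem_rationalSeries hs₀ h0)) j)

end PowerSection

section NormalForm

open PowerSeries Finset

variable {n d g m : ℕ} {k : Fin (n + 2) → ℕ} {i : Fin (n + 2)} {l : ℕ}

/-- The sequences that can occur as vanishing orders at a hyperelliptic cusp of genus `g`: they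
start with `0` and `2` and their terms lie in the semigroup `⟨2, 2g + 1⟩`. -/
structure IsOrderSequence (g : ℕ) (k : Fin (n + 2) → ℕ) : Prop where
  strictMono : StrictMono k
  zero : k 0 = 0
  one : k 1 = 2
  even_or_le : ∀ i, Even (k i) ∨ 2 * g + 1 ≤ k i

theorem IsOrderSequence.two_lt (hk : IsOrderSequence g k) (hi : 2 ≤ (i : ℕ)) : 2 < k i :=
  hk.one ▸ hk.strictMono (Fin.lt_def.mpr (by rwa [Fin.val_one]))

theorem IsHyperellipticCusp.isOrderSequence {a : Coeffs (n + 1) d} {v w : Fin 2 → ℂ}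
    (h : IsHyperellipticCusp g a v w i) (hg : 0 < g) (h_mono : StrictMono k)
    (hk : vanishingOrders a v w i = Set.range k) : IsOrderSequence g k := by
  have even_or_le (l) : Even (k l) ∨ 2 * g + 1 ≤ k l :=
    h.even_or_le_of_mem_vanishingOrders (hk ▸ Set.mem_range_self l)
  obtain ⟨i₀, hi₀⟩ : 0 ∈ Set.range k := hk ▸ h.zero_mem_vanishingOrders
  obtain ⟨i₂, hi₂⟩ : 2 ∈ Set.range k := hk ▸ h.two_mem_vanishingOrders hg
  have k_zero : k 0 = 0 := Nat.le_zero.mp (hi₀ ▸ h_mono.monotone (Fin.zero_le i₀))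
  refine ⟨h_mono, k_zero, le_antisymm ?_ ?_, even_or_le⟩
  · refine (h_mono.monotone (Fin.one_le_of_ne_zero fun h_eq => ?_)).trans_eq hi₂
    rw [h_eq] at hi₂
    omega
  · have : k 0 < k 1 := h_mono Fin.zero_lt_one
    have := even_or_le 1
    grind

/-- The possible values of the largest `j < g` for which `t ^ (2g - 1)` has a nonzero coefficient
in the `j`-th power section. The coefficient matters only if the forms have degree less than
`2g - 1`; otherwise the value is set to `g`. -/
def IsTopIndex (d g m : ℕ) : Prop :=
  (2 * g ≤ d + 1 ∧ m = g) ∨ (d + 2 = 2 * g ∧ 1 ≤ m ∧ m < g)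

/-- A cuspidal morphism in normal form: the point `(1 : θ)` of the cusp, the reduced echelon basis
`G` of the sections expanded there, whose leading terms are `t ^ k i`, and the matrix `A`
recovering the original sections from `G`. Modulo `t ^ (2g)` the sections are combinations, with
coefficients `c`, of the power sections of `G 0` and `G 1`, and `m` is the largest index of a power
section whose coefficient at `t ^ (2g - 1)` does not vanish (see `IsTopIndex`). -/
structure NormalForm (n d g m : ℕ) (k : Fin (n + 2) → ℕ) where
  θ : ℂ
  A : Matrix (Fin (n + 2)) (Fin (n + 2)) ℂ
  G : Fin (n + 2) → PowerSeries ℂ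
  c : Fin (n + 2) → ℕ → ℂ
  coeff_pivot : ∀ i l, coeff (k l) (G i) = if l = i then 1 else 0
  coeff_of_lt : ∀ i, ∀ l < k i, coeff l (G i) = 0
  coeff_of_degree_lt : ∀ i l, d < l → coeff l (G i) = 0
  X_pow_dvd : ∀ i, X ^ (2 * g) ∣ G i - ∑ j ∈ range g, c i j • powerSection (G 0) (G 1) j
  isTopIndex : IsTopIndex d g m
  coeff_top_of_lt : ∀ j, m < j → j < g → coeff (2 * g - 1) (powerSection (G 0) (G 1) j) = 0
  coeff_top_ne_zero : 1 < m → m < g → coeff (2 * g - 1) (powerSection (G 0) (G 1) m) ≠ 0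

namespace NormalForm

theorem constantCoeff_zero (hk : IsOrderSequence g k) (x : NormalForm n d g m k) :
    constantCoeff (x.G 0) = 1 := by
  simpa [hk.zero] using x.coeff_pivot 0 0

theorem coeff_one_of_lt (hk : IsOrderSequence g k) (x : NormalForm n d g m k) :
    ∀ l < 2, coeff l (x.G 1) = 0 :=
  fun l hl => x.coeff_of_lt 1 l (hk.one.symm ▸ hl)

theorem coeff_one_two (hk : IsOrderSequence g k) (x : NormalForm n d g m k) :
    coeff 2 (x.G 1) = 1 := by
  simpa [hk.one] using x.coeff_pivot 1 1

theorem order_le_degree (x : NormalForm n d g m k) (i : Fin (n + 2)) : k i ≤ d := by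
  by_contra! h
  simpa [x.coeff_of_degree_lt i _ h] using x.coeff_pivot i i

theorem coeff_eq_sum (x : NormalForm n d g m k) (i : Fin (n + 2)) (hl : l < 2 * g) :
    coeff l (x.G i) = ∑ j ∈ range g, x.c i j * coeff l (powerSection (x.G 0) (x.G 1) j) := by
  have := X_pow_dvd_iff.mp (x.X_pow_dvd i) l hl
  simpa only [map_sub, sub_eq_zero, map_sum, coeff_smul, smul_eq_mul] using this

theorem coeff_eq_sum_add (x : NormalForm n d g m k) (i : Fin (n + 2)) (hl : l < 2 * g) {j : ℕ}
    (hj : j < g) (h : ∀ j', j < j' → j' < g → coeff l (powerSection (x.G 0) (x.G 1) j') = 0) :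
    coeff l (x.G i) =
      ∑ j' ∈ range j, x.c i j' * coeff l (powerSection (x.G 0) (x.G 1) j') +
        x.c i j * coeff l (powerSection (x.G 0) (x.G 1) j) := by
  rw [x.coeff_eq_sum i hl, ← sum_range_succ]
  refine (sum_subset (range_mono hj) fun j' hj' h_not => ?_).symm
  rw [h j' (by simpa using h_not) (by simpa using hj'), mul_zero]

theorem coeff_two_mul (hk : IsOrderSequence g k) (x : NormalForm n d g m k) (i : Fin (n + 2))
    {j : ℕ} (hj : j < g) : coeff (2 * j) (x.G i) =
      ∑ j' ∈ range j, x.c i j' * coeff (2 * j) (powerSection (x.G 0) (x.G 1) j') + x.c i j := by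
  rw [x.coeff_eq_sum_add i (by omega) hj fun j' h _ =>
      coeff_powerSection_of_lt (x.coeff_one_of_lt hk) (by omega),
    coeff_powerSection_self (x.constantCoeff_zero hk) (x.coeff_one_of_lt hk)
      (x.coeff_one_two hk), mul_one]

theorem sum_top_eq_zero (x : NormalForm n d g m k) (i : Fin (n + 2)) (hm : m < g) :
    ∑ j ∈ range m, x.c i j * coeff (2 * g - 1) (powerSection (x.G 0) (x.G 1) j) +
      x.c i m * coeff (2 * g - 1) (powerSection (x.G 0) (x.G 1) m) = 0 := by
  have h_degree : d < 2 * g - 1 := by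
    have := x.isTopIndex
    unfold IsTopIndex at this
    omega
  rw [← x.coeff_eq_sum_add i (by omega) hm x.coeff_top_of_lt, x.coeff_of_degree_lt i _ h_degree]

theorem order_ne_two_mul (hk : IsOrderSequence g k) (x : NormalForm n d g m k)
    (hi : 2 ≤ (i : ℕ)) (hm : m < g) : k i ≠ 2 * m := by
  intro h_eq
  have := hk.two_lt hi
  have c_eq_zero (j : ℕ) (hj : j < m) : x.c i j = 0 := by
    induction j using Nat.strong_induction_on with
    | _ j ih =>
      have := x.coeff_two_mul hk i (hj.trans hm)
      rwa [x.coeff_of_lt i _ (by omega), sum_eq_zero, zero_add, eq_comm] at this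
      intro j' hj'
      rw [ih j' (mem_range.mp hj') ((mem_range.mp hj').trans hj), zero_mul]
  have c_top_eq_zero : x.c i m = 0 := by
    have := x.sum_top_eq_zero i hm
    rw [sum_eq_zero fun j hj => by rw [c_eq_zero j (mem_range.mp hj), zero_mul], zero_add] at this
    exact (mul_eq_zero.mp this).resolve_right (x.coeff_top_ne_zero (by omega) hm)
  have := x.coeff_two_mul hk i hm
  rw [sum_eq_zero fun j hj => by rw [c_eq_zero j (mem_range.mp hj), zero_mul], c_top_eq_zero,
    ← h_eq, x.coeff_pivot i i, if_pos rfl, add_zero] at this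
  exact one_ne_zero this

end NormalForm

end NormalForm

section Parameter

open PowerSeries Finset

variable {n d g m : ℕ} {k : Fin (n + 2) → ℕ} {i : Fin (n + 2)} {l : ℕ}

/-- The positions `(i, l)` of the coefficients `coeff l (G i)` of a normal form that are functions
of the other coefficients. -/
def IsDetermined (g m : ℕ) (k : Fin (n + 2) → ℕ) (i : Fin (n + 2)) (l : ℕ) : Prop :=
  (i = 1 ∧ Odd l ∧ l + 2 * m + 1 ≤ 2 * g) ∨ (2 ≤ (i : ℕ) ∧ Odd l ∧ l < 2 * g) ∨
    (2 ≤ (i : ℕ) ∧ m < g ∧ k i < 2 * m ∧ l = 2 * m)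

open Classical in
/-- The `l` for which `coeff l (G i)` is a free coefficient of a normal form. -/
def freeRow (d g m : ℕ) (k : Fin (n + 2) → ℕ) (i : Fin (n + 2)) : Finset ℕ :=
  {l ∈ range (d + 1) | k i ≤ l ∧ l ∉ Set.range k ∧ ¬ IsDetermined g m k i l}

theorem mem_freeRow : l ∈ freeRow d g m k i ↔
    l ≤ d ∧ k i ≤ l ∧ l ∉ Set.range k ∧ ¬ IsDetermined g m k i l := by
  classical
  rw [freeRow, mem_filter, mem_range, Nat.lt_succ_iff]

/-- The free parameters of a normal form: the position of the cusp, the entries of the matrix `A`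
and the free coefficients. -/
abbrev Parameter (d g m : ℕ) (k : Fin (n + 2) → ℕ) : Type :=
  Unit ⊕ (Fin (n + 2) × Fin (n + 2)) ⊕ Σ i, freeRow d g m k i

namespace NormalForm

/-- The values of the free parameters at a normal form. -/
def parameter : Parameter d g m k → NormalForm n d g m k → ℂ
  | .inl _, x => x.θ
  | .inr (.inl p), x => x.A p.1 p.2
  | .inr (.inr p), x => coeff p.2 (x.G p.1)

/-- The morphism with a given normal form, up to a permutation `e` of the monomials. -/
def point (e : Equiv.Perm (Fin (d + 1))) (x : NormalForm n d g m k) : Coeffs (n + 1) d :=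
  fun p => formCoeffs d x.θ (∑ l, x.A p.1 l • x.G l) (e p.2)

theorem θ_mem_rationalFunctions :
    (fun x : NormalForm n d g m k => x.θ) ∈ rationalFunctions parameter :=
  mem_rationalFunctions (u := parameter) (.inl ())

theorem A_mem_rationalFunctions (i l : Fin (n + 2)) :
    (fun x : NormalForm n d g m k => x.A i l) ∈ rationalFunctions parameter :=
  mem_rationalFunctions (u := parameter) (.inr (.inl (i, l)))

theorem coeff_mem_rationalFunctions (hl : ¬ IsDetermined g m k i l) :
    (fun x : NormalForm n d g m k => coeff l (x.G i)) ∈ rationalFunctions parameter := by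
  by_cases h_degree : d < l
  · simp only [coeff_of_degree_lt _ i l h_degree]
    exact zero_mem _
  by_cases h_lt : l < k i
  · simp only [coeff_of_lt _ i l h_lt]
    exact zero_mem _
  by_cases h_pivot : l ∈ Set.range k
  · obtain ⟨i', rfl⟩ := h_pivot
    simp only [coeff_pivot]
    exact algebraMap_mem (rationalFunctions parameter) _
  · have h_free : l ∈ freeRow d g m k i :=
      mem_freeRow.mpr ⟨not_lt.mp h_degree, not_lt.mp h_lt, h_pivot, hl⟩
    exact mem_rationalFunctions (u := parameter) (.inr (.inr ⟨i, l, h_free⟩))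

theorem zero_mem_rationalSeries :
    (fun x : NormalForm n d g m k => x.G 0) ∈ rationalSeries parameter :=
  fun _ => coeff_mem_rationalFunctions (by simp [IsDetermined])

theorem constantCoeff_zero_ne_zero (hk : IsOrderSequence g k) (x : NormalForm n d g m k) :
    constantCoeff (x.G 0) ≠ 0 :=
  x.constantCoeff_zero hk ▸ one_ne_zero

/-- If `l = r + 2` is a determined position, then the vanishing of the coefficient of
`t ^ (2g - 1)` in the power section with index `j = (2g - 1 - r) / 2` determines `coeff l (G 1)`
from the lower coefficients. -/
theorem one_mem_rationalSeries (hk : IsOrderSequence g k) :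
    (fun x : NormalForm n d g m k => x.G 1) ∈ rationalSeries parameter := by
  intro l
  induction l using Nat.strong_induction_on with
  | _ l ih =>
    by_cases h_free : ¬ IsDetermined g m k 1 l
    · exact coeff_mem_rationalFunctions h_free
    by_cases h_lt : l < 2
    · simp only [coeff_one_of_lt hk _ l h_lt]
      exact zero_mem _
    obtain ⟨h_odd, hl⟩ : Odd l ∧ l + 2 * m + 1 ≤ 2 * g := by
      simpa [IsDetermined] using h_free
    obtain ⟨r, rfl⟩ : ∃ r, l = 2 * r + 1 + 2 := by
      obtain ⟨s, rfl⟩ := h_odd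
      exact ⟨s - 1, by omega⟩
    obtain ⟨j, rfl⟩ : ∃ j, g = j + r + 1 := ⟨g - r - 1, by omega⟩
    have := coeff_mem_rationalFunctions_of_coeff_mul_pow
      (u := parameter (n := n) (d := d) (g := j + r + 1) (m := m) (k := k))
      (Q := fun x => x.G 0 * (x.G 0)⁻¹ ^ j)
      (V := fun x => PowerSeries.mk fun l => coeff (l + 2) (x.G 1))
      (r := 2 * r + 1) (j := j) (by omega) (Nat.cast_ne_zero.mpr (by omega))
      (mul_mem zero_mem_rationalSeries (pow_mem (inv_mem_rationalSeries zero_mem_rationalSeries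
        (constantCoeff_zero_ne_zero hk)) j))
      (fun x => by simp [x.constantCoeff_zero hk]) (fun x => by simp [x.coeff_one_two hk])
      (fun s hs => by simpa only [coeff_mk] using ih (s + 2) (by omega)) ?_
    · simpa only [coeff_mk] using this
    convert zero_mem (rationalFunctions parameter) with x
    have h_top := x.coeff_top_of_lt j (by omega) (by omega)
    rwa [powerSection_eq_X_pow_mul (x.coeff_one_of_lt hk),
      show 2 * (j + r + 1) - 1 = (2 * r + 1) + 2 * j by omega, coeff_X_pow_mul] at h_top

theorem powerSection_mem_rationalSeries (hk : IsOrderSequence g k) (j : ℕ) :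
    (fun x : NormalForm n d g m k => powerSection (x.G 0) (x.G 1) j) ∈
      rationalSeries parameter :=
  HyperellipticCusp.powerSection_mem_rationalSeries zero_mem_rationalSeries
    (one_mem_rationalSeries hk) (constantCoeff_zero_ne_zero hk) j

theorem c_mem_rationalFunctions (hk : IsOrderSequence g k) (hi : 2 ≤ (i : ℕ)) {j : ℕ}
    (hj : j < g) :
    (fun x : NormalForm n d g m k => x.c i j) ∈ rationalFunctions parameter := by
  induction j using Nat.strong_induction_on with
  | _ j ih =>
    have sum_mem_rational (l : ℕ) : (fun x : NormalForm n d g m k => ∑ j' ∈ range j,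
        x.c i j' * coeff l (powerSection (x.G 0) (x.G 1) j')) ∈ rationalFunctions parameter := by
      convert sum_mem (S := rationalFunctions _) fun j' hj' =>
        mul_mem (ih j' (mem_range.mp hj') ((mem_range.mp hj').trans hj))
          (powerSection_mem_rationalSeries hk j' l) with x
      simp
    by_cases h_det : j = m ∧ k i < 2 * m
    · obtain ⟨rfl, h_lt⟩ := h_det
      have top_ne_zero (x : NormalForm n d g j k) :=
        x.coeff_top_ne_zero (by have := hk.two_lt hi; omega) hj
      convert mul_mem (neg_mem (sum_mem_rational (2 * g - 1))) (inv_mem_rationalFunctions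
        (powerSection_mem_rationalSeries hk j (2 * g - 1)) top_ne_zero) with x
      exact (eq_mul_inv_iff_mul_eq₀ (top_ne_zero x)).mpr
        (eq_neg_of_add_eq_zero_right (x.sum_top_eq_zero i hj))
    · have h_free : ¬ IsDetermined g m k i (2 * j) := by
        have : ¬ Odd (2 * j) := by simp
        grind [IsDetermined]
      convert sub_mem (coeff_mem_rationalFunctions h_free) (sum_mem_rational (2 * j)) with x
      exact eq_sub_of_add_eq' (x.coeff_two_mul hk i hj).symm

theorem G_mem_rationalSeries_of_two_le (hk : IsOrderSequence g k) (hi : 2 ≤ (i : ℕ)) :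
    (fun x : NormalForm n d g m k => x.G i) ∈ rationalSeries parameter := by
  intro l
  rcases lt_or_ge l (2 * g) with hl | hl
  · convert sum_mem (S := rationalFunctions _) fun j hj =>
      mul_mem (c_mem_rationalFunctions hk hi (mem_range.mp hj))
        (powerSection_mem_rationalSeries hk j l) with x
    simp [x.coeff_eq_sum i hl]
  · exact coeff_mem_rationalFunctions (by unfold IsDetermined; omega)

theorem G_mem_rationalSeries (hk : IsOrderSequence g k) (i : Fin (n + 2)) :
    (fun x : NormalForm n d g m k => x.G i) ∈ rationalSeries parameter := by
  induction i using Fin.cases with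
  | zero => exact zero_mem_rationalSeries
  | succ i =>
    induction i using Fin.cases with
    | zero => exact one_mem_rationalSeries hk
    | succ i => exact G_mem_rationalSeries_of_two_le hk (by simp)

theorem point_mem_rationalFunctions (hk : IsOrderSequence g k) (e : Equiv.Perm (Fin (d + 1)))
    (p : Fin (n + 2) × Fin (d + 1)) :
    (fun x : NormalForm n d g m k => x.point e p) ∈ rationalFunctions parameter := by
  have coeff_mem (l : ℕ) : (fun x : NormalForm n d g m k => coeff l (∑ i, x.A p.1 i • x.G i)) ∈
      rationalFunctions parameter := by
    convert sum_mem (S := rationalFunctions _) (t := univ) fun i _ =>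
      mul_mem (A_mem_rationalFunctions p.1 i) (G_mem_rationalSeries hk i l) with x
    simp
  have θ_mem (l : ℕ) : (fun x : NormalForm n d g m k => (-x.θ) ^ l) ∈
      rationalFunctions parameter :=
    pow_mem (neg_mem θ_mem_rationalFunctions) l
  convert sum_mem (S := rationalFunctions _) (t := range (d + 1)) fun l _ => mul_mem (mul_mem
    (algebraMap_mem (rationalFunctions _) (l.choose (e p.2) : ℂ)) (θ_mem (l - e p.2)))
    (coeff_mem l) with x
  rw [point, formCoeffs_apply]
  simp

theorem zariskiDim_range_point_le (hk : IsOrderSequence g k) (e : Equiv.Perm (Fin (d + 1))) :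
    zariskiDim (Set.range (point e : NormalForm n d g m k → _)) ≤
      (1 + (n + 2) ^ 2 + ∑ i, (freeRow d g m k i).card : ℕ) := by
  refine (zariskiDim_range_le (point_mem_rationalFunctions hk e)).trans_eq ?_
  simp [sq, add_assoc]

end NormalForm

end Parameter

section ExistsNormalForm

open PowerSeries

variable {n d g : ℕ} {v w : Fin 2 → ℂ}

theorem exists_isTopIndex (s : ℕ → ℂ) (hd : 2 ≤ d) (hgd : 2 * g ≤ d + 2) :
    ∃ m, IsTopIndex d g m ∧ (∀ j, m < j → j < g → s j = 0) ∧ (1 < m → m < g → s m ≠ 0) := by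
  classical
  rcases Nat.lt_or_ge (d + 1) (2 * g) with h_lt | h_ge
  · let P (j : ℕ) : Prop := j = 1 ∨ s j ≠ 0
    have one_le : 1 ≤ Nat.findGreatest P (g - 1) := Nat.le_findGreatest (by omega) (.inl rfl)
    have le_pred : Nat.findGreatest P (g - 1) ≤ g - 1 := Nat.findGreatest_le _
    refine ⟨Nat.findGreatest P (g - 1), .inr ⟨by omega, one_le, by omega⟩, fun j hj hjg => ?_,
      fun h_one _ => ?_⟩
    · have := Nat.findGreatest_is_greatest (P := P) hj (by omega)
      exact not_not.mp (not_or.mp this).2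
    · exact (Nat.findGreatest_of_ne_zero (P := P) rfl (by omega)).resolve_left h_one.ne'
  · exact ⟨g, .inl ⟨h_ge, rfl⟩, by omega, by omega⟩

theorem IsHyperellipticCusp.exists_X_pow_dvd_sub_sum_powerSection {a : Coeffs n d}
    {j : Fin (n + 1)} (h : IsHyperellipticCusp g a v w j) {s₀ s₁ f : PowerSeries ℂ}
    (hs₀ : s₀ ∈ Submodule.span ℂ (Set.range (expansion a v w)))
    (hs₁ : s₁ ∈ Submodule.span ℂ (Set.range (expansion a v w)))
    (hf : f ∈ Submodule.span ℂ (Set.range (expansion a v w)))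
    (h0 : constantCoeff s₀ ≠ 0) (h1 : s₁.order = 2) :
    ∃ c : ℕ → ℂ, X ^ (2 * g) ∣ f - ∑ l ∈ Finset.range g, c l • powerSection s₀ s₁ l := by
  have order_quotient : (s₁ * s₀⁻¹).order = 2 := by
    rw [order_mul, h1, order_zero_of_unit, add_zero]
    rw [isUnit_iff_constantCoeff, constantCoeff_inv]
    exact (inv_ne_zero h0).isUnit
  obtain ⟨c, hc⟩ := exists_X_pow_dvd_sub_sum_pow h.order_ne_of_mem_range
    (h.chart.mul_inv_mem_range hs₁ hs₀ h0) order_quotient (h.chart.mul_inv_mem_range hf hs₀ h0)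
  have mul_quotient : s₀ * (f * s₀⁻¹) = f := by
    rw [mul_left_comm, PowerSeries.mul_inv_cancel _ h0, mul_one]
  refine ⟨c, ?_⟩
  simpa only [mul_sub, Finset.mul_sum, mul_quotient, mul_smul_comm] using! hc.mul_left s₀

variable {a : Coeffs (n + 1) d} {j : Fin (n + 2)} {k : Fin (n + 2) → ℕ}

theorem IsHyperellipticCusp.exists_normalForm {θ : ℂ}
    (h : IsHyperellipticCusp g a ![1, θ] ![0, 1] j)
    (ha : LinearIndependent ℂ fun i l => a (i, l)) (hgd : 2 * g ≤ d + 2)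
    (hk : IsOrderSequence g k) (h_orders : vanishingOrders a ![1, θ] ![0, 1] j = Set.range k) :
    ∃ (m : ℕ) (x : NormalForm n d g m k), x.point 1 = a := by
  set E := expansion a ![1, θ] ![0, 1]
  have := FiniteDimensional.span_of_finite ℂ (Set.finite_range E)
  rw [h.chart.vanishingOrders_eq_orderSet] at h_orders
  obtain ⟨G, G_mem, G_pivot, G_low, hG⟩ := exists_echelonBasis
    (finrank_span_eq_card (linearIndependent_expansion ha)) h_orders
  have G_degree (i l) (hl : d < l) : coeff l (G i) = 0 := by
    have : Submodule.span ℂ (Set.range E) ≤ LinearMap.ker (coeff l) :=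
      Submodule.span_le.mpr (by rintro _ ⟨i, rfl⟩; exact coeff_expansion_eq_zero hl i)
    exact this (G_mem i)
  have order_G (i) : (G i).order = k i :=
    order_eq_nat.mpr ⟨by rw [G_pivot, if_pos rfl]; exact one_ne_zero, G_low i⟩
  have hG₀ : constantCoeff (G 0) ≠ 0 := by
    have := G_pivot 0 0
    rw [hk.zero, coeff_zero_eq_constantCoeff_apply, if_pos rfl] at this
    exact this ▸ one_ne_zero
  have two_le : 2 ≤ d := by
    by_contra! hd
    simpa [hk.one, G_degree 1 2 hd] using G_pivot 1 1
  choose c hc using fun i => h.exists_X_pow_dvd_sub_sum_powerSection (G_mem 0) (G_mem 1) (G_mem i)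
    hG₀ (by rw [order_G, hk.one, Nat.cast_ofNat])
  obtain ⟨m, hm, top_of_lt, top_ne_zero⟩ := exists_isTopIndex
    (fun l => coeff (2 * g - 1) (powerSection (G 0) (G 1) l)) two_le hgd
  refine ⟨m, ⟨θ, .of fun i l => coeff (k l) (E i), G, c, G_pivot, G_low, G_degree, hc, hm,
    top_of_lt, top_ne_zero⟩, ?_⟩
  ext p
  have : ∑ l, coeff (k l) (E p.1) • G l = E p.1 := (hG _ (Submodule.subset_span ⟨p.1, rfl⟩)).symm
  simp only [NormalForm.point, Matrix.of_apply, this]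
  exact formCoeffs_expansion p.1 p.2

theorem IsHyperellipticCusp.exists_mem_range_point (h : IsHyperellipticCusp g a v w j)
    (ha : LinearIndependent ℂ fun i l => a (i, l)) (hgd : 2 * g ≤ d + 2)
    (hk : IsOrderSequence g k) (h_orders : vanishingOrders a v w j = Set.range k) :
    ∃ m e, a ∈ Set.range (NormalForm.point e : NormalForm n d g m k → _) := by
  obtain ⟨e, θ, h_normalized, h_eq⟩ := h.exists_normalized
  obtain ⟨m, x, hx⟩ := h_normalized.exists_normalForm
    (linearIndependent_comp_perm e ha) hgd hk (h_eq.trans h_orders)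
  refine ⟨m, e.symm, x, ?_⟩
  ext p
  exact (congrFun hx (p.1, e.symm p.2)).trans (by simp)

end ExistsNormalForm

section Counting

open Finset

variable {n d g m : ℕ} {k : Fin (n + 2) → ℕ} {i : Fin (n + 2)}

/-- The number of positive elements `≤ s` of the semigroup `⟨2, 2g + 1⟩`, for `s` in it. -/
def position (g s : ℕ) : ℕ :=
  if s ≤ 2 * g then s / 2 else s - g

namespace IsOrderSequence

theorem strictMono_position (hk : IsOrderSequence g k) : StrictMono fun i => position g (k i) := by
  intro i j hij
  have := hk.strictMono hij
  have := hk.even_or_le i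
  have := hk.even_or_le j
  simp only [position]
  grind

theorem le_position (hk : IsOrderSequence g k) (i : Fin (n + 2)) : (i : ℕ) ≤ position g (k i) := by
  induction i using Fin.induction with
  | zero => exact Nat.zero_le _
  | succ i ih => exact ih.trans_lt (hk.strictMono_position Fin.castSucc_lt_succ)

theorem order_le_two_mul_position (hk : IsOrderSequence g k) (i : Fin (n + 2)) :
    k i ≤ 2 * position g (k i) := by
  have := hk.even_or_le i
  unfold position
  grind

theorem two_mul_add_one_notMem_range (hk : IsOrderSequence g k) {q : ℕ} (hq : q < g) :
    2 * q + 1 ∉ Set.range k := by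
  rintro ⟨i, hi⟩
  have := hk.even_or_le i
  grind

end IsOrderSequence

/-- The odd numbers `2q + 1` with `a ≤ q < b`. -/
def oddsBetween (a b : ℕ) : Finset ℕ :=
  (Ico a b).image fun q => 2 * q + 1

theorem mem_oddsBetween {a b l : ℕ} :
    l ∈ oddsBetween a b ↔ ∃ q, (a ≤ q ∧ q < b) ∧ 2 * q + 1 = l := by
  simp [oddsBetween]

theorem card_oddsBetween (a b : ℕ) : (oddsBetween a b).card = b - a := by
  rw [oddsBetween, card_image_of_injective _ fun q q' h => by simpa using h, Nat.card_Ico]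

namespace NormalForm

theorem card_freeRow_add_le (hk : IsOrderSequence g k) (x : NormalForm n d g m k)
    (i : Fin (n + 2)) (D : Finset ℕ)
    (hD : ∀ l ∈ D, (k i ≤ l ∧ l ≤ d) ∧ l ∉ Set.range k ∧ IsDetermined g m k i l) :
    (freeRow d g m k i).card + ((n + 2 - i) + D.card) + k i ≤ d + 1 := by
  set P : Finset ℕ := (Ici i).image k
  have card_P : P.card = n + 2 - i := by
    rw [card_image_of_injective _ hk.strictMono.injective, Fin.card_Ici]
  have mem_P {l : ℕ} (hl : l ∈ P) : (k i ≤ l ∧ l ≤ d) ∧ l ∈ Set.range k := by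
    obtain ⟨i', hi', rfl⟩ := mem_image.mp hl
    exact ⟨⟨hk.strictMono.monotone (mem_Ici.mp hi'), x.order_le_degree i'⟩, i', rfl⟩
  have P_disjoint : Disjoint P D :=
    disjoint_left.mpr fun l hP hl => (hD l hl).2.1 (mem_P hP).2
  have free_disjoint : Disjoint (freeRow d g m k i) (P ∪ D) := by
    refine disjoint_left.mpr fun l h_free hl => ?_
    obtain ⟨-, -, h_pivot, h_det⟩ := mem_freeRow.mp h_free
    rcases mem_union.mp hl with hP | hl
    · exact h_pivot (mem_P hP).2
    · exact h_det (hD l hl).2.2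
  have h_subset : freeRow d g m k i ∪ (P ∪ D) ⊆ Icc (k i) d := by
    refine union_subset (fun l hl => ?_) (union_subset (fun l hl => ?_) fun l hl => ?_)
    · exact mem_Icc.mpr ⟨(mem_freeRow.mp hl).2.1, (mem_freeRow.mp hl).1⟩
    · exact mem_Icc.mpr (mem_P hl).1
    · exact mem_Icc.mpr (hD l hl).1
  have := card_le_card h_subset
  rw [card_union_of_disjoint free_disjoint, card_union_of_disjoint P_disjoint, card_P,
    Nat.card_Icc] at this
  have := x.order_le_degree i
  omega

theorem card_freeRow_zero_add_le (hk : IsOrderSequence g k) (x : NormalForm n d g m k) :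
    (freeRow d g m k 0).card + (n + 2) ≤ d + 1 := by
  simpa [hk.zero] using x.card_freeRow_add_le hk 0 ∅ (by simp)

theorem card_freeRow_one_add_le (hk : IsOrderSequence g k) (x : NormalForm n d g m k) :
    (freeRow d g m k 1).card + (n + 3 + (g - m - 1)) ≤ d + 1 := by
  have h_top : (2 * g ≤ d + 1 ∧ m = g) ∨ (d + 2 = 2 * g ∧ 1 ≤ m ∧ m < g) := x.isTopIndex
  have := x.card_freeRow_add_le hk 1 (oddsBetween 1 (g - m)) fun l hl => by
    obtain ⟨q, hq, rfl⟩ := mem_oddsBetween.mp hl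
    have h_odd : Odd (2 * q + 1) := ⟨q, rfl⟩
    exact ⟨by rw [hk.one]; omega, hk.two_mul_add_one_notMem_range (by omega),
      .inl ⟨rfl, h_odd, by omega⟩⟩
  rw [card_oddsBetween, hk.one, Fin.val_one] at this
  omega

theorem card_freeRow_add_le_of_le_degree (hk : IsOrderSequence g k) (x : NormalForm n d g m k)
    (hi : 2 ≤ (i : ℕ)) (hd : 2 * g ≤ d + 1) :
    (freeRow d g m k i).card + (n + 2 - i + g + position g (k i)) ≤ d + 1 := by
  have := x.card_freeRow_add_le hk i (oddsBetween (k i / 2) g) fun l hl => by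
    obtain ⟨q, hq, rfl⟩ := mem_oddsBetween.mp hl
    have h_odd : Odd (2 * q + 1) := ⟨q, rfl⟩
    exact ⟨by omega, hk.two_mul_add_one_notMem_range hq.2, .inr (.inl ⟨hi, h_odd, by omega⟩)⟩
  rw [card_oddsBetween] at this
  have := hk.even_or_le i
  unfold position
  grind

theorem card_freeRow_add_le_of_degree_lt (hk : IsOrderSequence g k) (x : NormalForm n d g m k)
    (hi : 2 ≤ (i : ℕ)) (hm : m < g) (hd : d + 2 = 2 * g) :
    (freeRow d g m k i).card + (n + 2 - i + g + position g (k i)) ≤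
      d + 1 + if 2 * m < k i then 1 else 0 := by
  have le_degree := x.order_le_degree i
  have k_ne := x.order_ne_two_mul hk hi hm
  have position_eq : position g (k i) = k i / 2 := by rw [position, if_pos (by omega)]
  have k_even : k i % 2 = 0 := by
    have := hk.even_or_le i
    grind
  have odds_determined (l) (hl : l ∈ oddsBetween (k i / 2) (g - 1)) :
      (k i ≤ l ∧ l ≤ d) ∧ l ∉ Set.range k ∧ IsDetermined g m k i l := by
    obtain ⟨q, hq, rfl⟩ := mem_oddsBetween.mp hl
    have h_odd : Odd (2 * q + 1) := ⟨q, rfl⟩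
    exact ⟨by omega, hk.two_mul_add_one_notMem_range (by omega),
      .inr (.inl ⟨hi, h_odd, by omega⟩)⟩
  split_ifs with h_lt
  · have := x.card_freeRow_add_le hk i _ odds_determined
    rw [card_oddsBetween] at this
    omega
  · have top_notMem : 2 * m ∉ Set.range k := by
      rintro ⟨i', hi'⟩
      rcases Nat.lt_or_ge i' 2 with h_small | h_large
      · have : k i' < k i := hk.strictMono (Fin.lt_def.mpr (by omega))
        omega
      · exact x.order_ne_two_mul hk h_large hm hi'
    have := x.card_freeRow_add_le hk i (insert (2 * m) (oddsBetween (k i / 2) (g - 1)))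
      ((forall_mem_insert ..).mpr
        ⟨⟨by omega, top_notMem, .inr (.inr ⟨hi, hm, by omega, rfl⟩)⟩, odds_determined⟩)
    rw [card_insert_of_notMem (by rw [mem_oddsBetween]; omega), card_oddsBetween] at this
    omega

theorem card_freeRow_succ_succ_add_le (hk : IsOrderSequence g k) (x : NormalForm n d g m k)
    (i : Fin n) :
    (freeRow d g m k i.succ.succ).card + (n + 2 + g) +
        (position g (k i.succ.succ) - (i + 2)) ≤
      d + 1 + if m < g ∧ 2 * m < k i.succ.succ then 1 else 0 := by
  have hi : 2 ≤ (i.succ.succ : ℕ) := by simp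
  have := hk.le_position i.succ.succ
  have val_eq : (i.succ.succ : ℕ) = i + 2 := rfl
  rcases x.isTopIndex with ⟨hd, -⟩ | ⟨hd, -, hm⟩
  · have := x.card_freeRow_add_le_of_le_degree hk hi hd
    omega
  · have := x.card_freeRow_add_le_of_degree_lt hk hi hm hd
    simp only [hm, true_and]
    omega

theorem card_filter_lt_le (hk : IsOrderSequence g k) (x : NormalForm n d g m k) :
    #{i : Fin n | m < g ∧ 2 * m < k i.succ.succ} ≤ g - m - 1 := by
  have k_even_of_lt (hm : m < g) (i : Fin n) :
      k i.succ.succ % 2 = 0 ∧ k i.succ.succ + 2 ≤ 2 * g := by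
    have := x.order_le_degree i.succ.succ
    have := hk.even_or_le i.succ.succ
    have := x.isTopIndex
    unfold IsTopIndex at this
    grind
  rw [← Nat.card_Ioo]
  refine card_le_card_of_injOn (fun i => k i.succ.succ / 2) (fun i hi => ?_)
    fun i hi i' _ h_eq => ?_
  · obtain ⟨hm, h_lt⟩ := (mem_filter.mp hi).2
    have := k_even_of_lt hm i
    exact mem_coe.mpr (mem_Ioo.mpr ⟨by grind, by grind⟩)
  · have hm := (mem_filter.mp hi).2.1
    have h_half : k i.succ.succ / 2 = k i'.succ.succ / 2 := h_eq
    have := k_even_of_lt hm i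
    have := k_even_of_lt hm i'
    have : k i.succ.succ = k i'.succ.succ := by omega
    exact Fin.succ_injective _ (Fin.succ_injective _ (hk.strictMono.injective this))

end NormalForm

/-- The lower bound that the parameter count gives for the codimension in `Mor (n + 1) d` of the
morphisms with vanishing orders `k` at a hyperelliptic cusp of genus `g`. -/
def codimBound (g : ℕ) (k : Fin (n + 2) → ℕ) : ℕ :=
  n * g + ∑ i : Fin n, (position g (k i.succ.succ) - (i + 2))

theorem sum_filter_two_le_val {M : Type*} [AddCommMonoid M] (f : Fin (n + 2) → M) :
    ∑ i with 2 ≤ i.val, f i = ∑ i : Fin n, f i.succ.succ := by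
  simp [sum_filter, Fin.sum_univ_succ]

theorem IsOrderSequence.le_codimBound (hk : IsOrderSequence g k) :
    (n * g + ∑ i with 2 ≤ i.val, ((k i : ℚ) / 2 - i.val) : ℚ) ≤ codimBound g k := by
  rw [sum_filter_two_le_val, codimBound]
  push_cast
  gcongr with i
  have h_le : i.val + 2 ≤ position g (k i.succ.succ) := hk.le_position i.succ.succ
  have h_order : (k i.succ.succ : ℚ) ≤ 2 * position g (k i.succ.succ) :=
    mod_cast hk.order_le_two_mul_position i.succ.succ
  rw [Nat.cast_sub h_le]
  push_cast [Fin.val_succ]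
  linarith

namespace NormalForm

theorem sum_card_freeRow_add_le (hk : IsOrderSequence g k) (x : NormalForm n d g m k) :
    1 + (n + 2) ^ 2 + ∑ i, (freeRow d g m k i).card + codimBound g k ≤ (n + 2) * (d + 1) := by
  have row_zero := x.card_freeRow_zero_add_le hk
  have row_one := x.card_freeRow_one_add_le hk
  have remaining_rows := sum_le_sum fun i (_ : i ∈ univ) => x.card_freeRow_succ_succ_add_le hk i
  have exceptional := x.card_filter_lt_le hk
  simp only [sum_add_distrib, sum_const, card_univ, Fintype.card_fin, smul_eq_mul, sum_boole,
    Nat.cast_id] at remaining_rows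
  rw [Fin.sum_univ_succ, Fin.sum_univ_succ, codimBound, Fin.succ_zero_eq_one]
  nlinarith

theorem zariskiDim_range_point_add_codimBound_le (hk : IsOrderSequence g k)
    (e : Equiv.Perm (Fin (d + 1))) :
    zariskiDim (Set.range (point e : NormalForm n d g m k → _)) + (codimBound g k : WithBot ℕ∞) ≤
      ((n + 2) * (d + 1) : ℕ) := by
  rcases isEmpty_or_nonempty (NormalForm n d g m k) with h_empty | ⟨⟨x⟩⟩
  · rw [Set.range_eq_empty, zariskiDim_empty, WithBot.bot_add]
    exact bot_le
  · refine (add_le_add_left (zariskiDim_range_point_le hk e) _).trans ?_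
    exact_mod_cast x.sum_card_freeRow_add_le hk

end NormalForm

end Counting

section Codimension

variable {n d g : ℕ} {v w : Fin 2 → ℂ}

theorem IsHyperellipticCusp.exists_strictMono {a : Coeffs n d} {j : Fin (n + 1)}
    (h : IsHyperellipticCusp g a v w j) (ha : LinearIndependent ℂ fun i l => a (i, l)) :
    ∃ k : Fin (n + 1) → ℕ, StrictMono k ∧ vanishingOrders a v w j = Set.range k := by
  obtain ⟨e, θ, h_normalized, h_eq⟩ := h.exists_normalized
  set b : Coeffs n d := fun p => a (p.1, e p.2)
  have independent : LinearIndependent ℂ (expansion b ![1, θ] ![0, 1]) :=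
    linearIndependent_expansion (linearIndependent_comp_perm e ha)
  have := FiniteDimensional.span_of_finite ℂ (Set.finite_range (expansion b ![1, θ] ![0, 1]))
  rw [← h_eq, h_normalized.chart.vanishingOrders_eq_orderSet]
  exact exists_strictMono_range_eq_orderSet _
    ((finrank_span_eq_card independent).trans (Fintype.card_fin _))

/-- Finitely many sets of normal forms cover `Y`, since only finitely many sequences are bounded
by the degree. -/
theorem exists_zariskiDim_add_codimBound_le {Y : Set (Coeffs (n + 1) d)}
    {K : Set (Fin (n + 2) → ℕ)} (hY : Y.Nonempty) (hYM : Y ⊆ Mor (n + 1) d)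
    (hgd : 2 * g ≤ d + 2) (hK : ∀ k ∈ K, IsOrderSequence g k)
    (h_cusp : ∀ a ∈ Y, ∃ v w j, IsHyperellipticCusp g a v w j ∧
      ∃ k ∈ K, vanishingOrders a v w j = Set.range k) :
    ∃ k ∈ K, zariskiDim Y + (codimBound g k : WithBot ℕ∞) ≤ ((n + 2) * (d + 1) : ℕ) := by
  have : Finite {k ∈ K | ∀ i, k i ≤ d} :=
    (Set.finite_Iic fun _ => d).subset fun k hk => hk.2
  obtain ⟨⟨k, m, e⟩, h_le⟩ := exists_zariskiDim_le_of_subset_iUnion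
    (ι := {k ∈ K | ∀ i, k i ≤ d} × Fin (g + 1) × Equiv.Perm (Fin (d + 1))) hY
    (Z := fun p => Set.range (NormalForm.point p.2.2 : NormalForm n d g p.2.1 p.1 → _))
    fun a ha => by
      obtain ⟨v, w, j, h, k, hk, h_orders⟩ := h_cusp a ha
      obtain ⟨m, e, x, hx⟩ := h.exists_mem_range_point (hYM ha).2 hgd (hK k hk) h_orders
      have hm : m < g + 1 := by
        have := x.isTopIndex
        unfold IsTopIndex at this
        omega
      exact Set.mem_iUnion.mpr ⟨(⟨k, hk, x.order_le_degree⟩, ⟨m, hm⟩, e), x, hx⟩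
  exact ⟨k, k.2.1, (add_le_add_left h_le _).trans
    (NormalForm.zariskiDim_range_point_add_codimBound_le (hK k k.2.1) e)⟩

theorem exists_hasCodim_Mor {Y : Set (Coeffs (n + 1) d)}
    {K : Set (Fin (n + 2) → ℕ)} (hY : Y.Nonempty) (hYM : Y ⊆ Mor (n + 1) d)
    (hgd : 2 * g ≤ d + 2) (hK : ∀ k ∈ K, IsOrderSequence g k)
    (h_cusp : ∀ a ∈ Y, ∃ v w j, IsHyperellipticCusp g a v w j ∧
      ∃ k ∈ K, vanishingOrders a v w j = Set.range k) :
    ∃ c, HasCodim Y (Mor (n + 1) d) c ∧ ∃ k ∈ K, codimBound g k ≤ c := by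
  obtain ⟨c, h_codim, le_codim⟩ := exists_hasCodim hY hYM
  obtain ⟨k, hk, h_le⟩ := exists_zariskiDim_add_codimBound_le hY hYM hgd hK h_cusp
  exact ⟨c, h_codim, k, hk, le_codim _ (h_le.trans_eq (zariskiDim_Mor (hY.mono hYM)).symm)⟩

end Codimension

end HyperellipticCusp

end

open HyperellipticCusp in
theorem theorem2p1_general (n d g : ℕ) (hg : 0 < g) (hd : 2 * g ≤ d + 2) {Y : Set (Coeffs n d)}
    (hY : Y.Nonempty) (hYM : Y ⊆ Mor n d) :
    (∀ k : Fin (n + 1) → ℕ, StrictMono k →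
      (∀ a ∈ Y, ∃ v w j, IsHyperellipticCusp g a v w j ∧ vanishingOrders a v w j = Set.range k) →
      ∃ c : ℕ, HasCodim Y (Mor n d) c ∧
        ((n : ℚ) - 1) * g + ∑ i with 2 ≤ i.val, ((k i : ℚ) / 2 - i.val) ≤ c) ∧
    ((∀ a ∈ Y, ∃ v w j, IsHyperellipticCusp g a v w j) →
      ∃ c : ℕ, HasCodim Y (Mor n d) c ∧ ((n : ℚ) - 1) * g ≤ c) := by
  cases n with
  | zero =>
    obtain ⟨c, h_codim, -⟩ := exists_hasCodim hY hYM
    have bound_le : (((0 : ℕ) : ℚ) - 1) * g ≤ c := by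
      have : (0 : ℚ) ≤ g + c := by positivity
      push_cast
      linarith
    refine ⟨fun k _ _ => ⟨c, h_codim, ?_⟩, fun _ => ⟨c, h_codim, bound_le⟩⟩
    rwa [Finset.filter_false_of_mem (by omega), Finset.sum_empty, add_zero]
  | succ n =>
    rw [Nat.cast_succ, add_sub_cancel_right]
    refine ⟨fun k h_mono h_cusp => ?_, fun h_cusp => ?_⟩
    · obtain ⟨a, ha⟩ := hY
      obtain ⟨v, w, j, h, h_orders⟩ := h_cusp a ha
      have hk := h.isOrderSequence hg h_mono h_orders
      obtain ⟨c, h_codim, _, rfl, h_le⟩ := exists_hasCodim_Mor (K := {k}) ⟨a, ha⟩ hYM hd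
        (by simpa using hk) (by simpa using h_cusp)
      exact ⟨c, h_codim, hk.le_codimBound.trans (mod_cast h_le)⟩
    · obtain ⟨c, h_codim, k, -, h_le⟩ := exists_hasCodim_Mor (K := {k | IsOrderSequence g k})
        hY hYM hd (fun _ => id) fun a ha => by
          obtain ⟨v, w, j, h⟩ := h_cusp a ha
          obtain ⟨k, h_mono, h_orders⟩ := h.exists_strictMono (hYM ha).2
          exact ⟨v, w, j, h, k, h.isOrderSequence hg h_mono h_orders, h_orders⟩
      exact ⟨c, h_codim, mod_cast (Nat.le_add_right _ _).trans h_le⟩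

theorem theorem2p1 (n d g : ℕ) (hg : 0 < g) (hn : n ≤ 2 * g) (hd : max n (2 * g - 2) ≤ d) :
    (∀ k : Fin (n + 1) → ℕ,
      (HyperellipticCusp.cuspStratum n d (HyperellipticCusp.hyperellipticSemigroup g) k).Nonempty →
      ∃ c : ℕ,
        HyperellipticCusp.HasCodim
          (HyperellipticCusp.cuspStratum n d (HyperellipticCusp.hyperellipticSemigroup g) k)
          (HyperellipticCusp.Mor n d) c ∧
        ((n : ℚ) - 1) * (g : ℚ) +
            ∑ i ∈ Finset.univ.filter (fun i : Fin (n + 1) => 2 ≤ i.val),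
              ((k i : ℚ) / 2 - (i.val : ℚ)) ≤ (c : ℚ)) ∧
    ((HyperellipticCusp.cuspLocus n d (HyperellipticCusp.hyperellipticSemigroup g)).Nonempty →
      ∃ c : ℕ,
        HyperellipticCusp.HasCodim
          (HyperellipticCusp.cuspLocus n d (HyperellipticCusp.hyperellipticSemigroup g))
          (HyperellipticCusp.Mor n d) c ∧
        ((n : ℚ) - 1) * (g : ℚ) ≤ (c : ℚ)) := by
  have hgd : 2 * g ≤ d + 2 := by omega
  refine ⟨fun k hY => ?_, fun hY => ?_⟩
  · obtain ⟨-, -, -, -, -, -, -, -, h_mono, -⟩ := id hY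
    exact (theorem2p1_general n d g hg hgd hY fun a ha => ha.1).1 k h_mono
      fun a ⟨_, v, w, j, chart, _, semigroup_eq, _, h_orders⟩ =>
        ⟨v, w, j, ⟨chart, semigroup_eq⟩, h_orders⟩
  · exact (theorem2p1_general n d g hg hgd hY fun a ha => ha.1).2
      fun a ⟨_, v, w, j, chart, _, semigroup_eq⟩ => ⟨v, w, j, chart, semigroup_eq⟩
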